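/- Let $\mathcal G$ be a (small) groupoid with set of objects $\mathcal G_0$, set of arrows $\mathcal G_1$, source $\mathsf s$ and target $\mathsf t$. A right $\mathcal G$-set is a set $X$ with a structure map $\varsigma\colon X\to\mathcal G_0$ and an action $(x,g)\mapsto xg$, defined when $\varsigma(x)=\mathsf t(g)$, such that $\varsigma(xg)=\mathsf s(g)$, $x\,\iota_{\varsigma(x)}=x$ and $(xg)h=x(gh)$; morphisms are the maps commuting with the structure maps and the actions. A categorified $\mathcal G$-set $\mathcal X$ is an internal category in the category of right $\mathcal G$-sets: right $\mathcal G$-sets $\mathcal X_0$ (objects) and $\mathcal X_1$ (arrows) with equivariant source, target, identity and composition maps satisfying the axioms of a category. Morphisms are internal functors and $2$-morphisms are internal natural transformations. Two categorified $\mathcal G$-sets $\mathcal X,\mathcal Y$ are weakly equivalent if there are morphisms $\varphi\colon\mathcal X\to\mathcal Y$, $\psi\colon\mathcal Y\to\mathcal X$ and $2$-isomorphisms $\psi\varphi\cong\mathrm{Id}_{\mathcal X}$, $\varphi\psi\cong\mathrm{Id}_{\mathcal Y}$. Call $\mathcal X$ finite if every fibre of the structure map $\mathcal X_1\to\mathcal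 G_0$ is finite (if $\mathcal G_0$ is finite, this means that $\mathcal X_1$ is finite). The weak equivalence classes of finite categorified $\mathcal G$-sets form a commutative rig with addition induced by the disjoint union, multiplication induced by the fibre product over $\mathcal G_0$, zero the class of $\emptyset$ and unit the class of the discrete categorified $\mathcal G$-set $\mathcal G_0$. Its Grothendieck ring is the categorified Burnside ring $\mathscr B^{c}(\mathcal G)$ of $\mathcal G$. For a group $H$, $\mathscr B^{c}(H)$ is the ring of $H$ viewed as a groupoid with one object; it is built from categorified right $H$-sets whose set of arrows is finite, with the Cartesian product as multiplication. **Corollary.** Let $\mathcal G$ be any groupoid and let $\mathrm{rep}(\mathcal G_0)\subseteq\mathcal G_0$ be a set of representatives of the connected components of $\mathcal G$. For $a\in\mathcal G_0$ let $\mathcal G^{a}=\{g\in\mathcal G_1 \mid \mathsf s(g)=\mathsf t(g)=a\}$ be the isotropy group at $a$. Then there is a (non-canonical) isomorphism of commutative rings $$\mathscr B^{c}(\mathcal G)\;\cong\;\prod_{a\in\mathrm{rep}(\mathcal G_0)}\mathscr B^{c}(\mathcal G^{a}).$$ -/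

import Mathlib

open CategoryTheory

universe u

/-! ## Right groupoid-sets -/

/-- A right `G`-set over a (small) groupoid `G`: a set `X` with a structure map `str : X → G₀` and
a right action `X ×_{str, t} G₁ → X`, `(x, g) ↦ x g`, where for `g : a ⟶ b` the source is `a` and
the target is `b`.  The product `g h` of arrows with `s(g) = t(h)` is `h ≫ g` in Mathlib. -/
structure RightGSet (G : Type u) [Groupoid.{u} G] where
  carrier : Type u
  str : carrier → G
  act : (x : carrier) → {a b : G} → (g : a ⟶ b) → str x = b → carrier
  str_act : ∀ (x : carrier) {a b : G} (g : a ⟶ b) (hx : str x = b), str (act x g hx) = a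
  act_id : ∀ x : carrier, act x (𝟙 (str x)) rfl = x
  act_act : ∀ (x : carrier) {a b c : G} (g : b ⟶ c) (h : a ⟶ b) (hx : str x = c),
    act (act x g hx) h (str_act x g hx) = act x (h ≫ g) hx

/-- A `G`-equivariant map between right `G`-sets (compatible with structure maps and actions). -/
structure EquivariantMap {G : Type u} [Groupoid.{u} G] (X Y : RightGSet G) where
  toFun : X.carrier → Y.carrier
  str_map : ∀ x, Y.str (toFun x) = X.str x
  map_act : ∀ (x : X.carrier) {a b : G} (g : a ⟶ b) (hx : X.str x = b),
    toFun (X.act x g hx) = Y.act (toFun x) g ((str_map x).trans hx)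

namespace RightGSet

variable {G : Type u} [Groupoid.{u} G]

theorem act_congr (X : RightGSet G) {x y : X.carrier} (h : x = y) {a b : G} (g : a ⟶ b)
    (hx : X.str x = b) (hy : X.str y = b) : X.act x g hx = X.act y g hy := by
  subst h; rfl

/-- The empty right `G`-set. -/
def empty (G : Type u) [Groupoid.{u} G] : RightGSet G where
  carrier := PEmpty
  str x := x.elim
  act x := x.elim
  str_act x := x.elim
  act_id x := x.elim
  act_act x := x.elim

/-- The right `G`-set `(G₀, id)`, with action `b g = a` for `g : a ⟶ b`. -/
def base (G : Type u) [Groupoid.{u} G] : RightGSet G where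
  carrier := G
  str x := x
  act _ {a _} _ _ := a
  str_act _ _ _ _ _ := rfl
  act_id _ := rfl
  act_act _ _ _ _ _ _ _ := rfl

/-- The disjoint union of two right `G`-sets. -/
def sum (X Y : RightGSet G) : RightGSet G where
  carrier := X.carrier ⊕ Y.carrier
  str := Sum.elim X.str Y.str
  act z {_ _} g hz := match z, hz with
    | .inl x, hx => .inl (X.act x g hx)
    | .inr y, hy => .inr (Y.act y g hy)
  str_act z {_ _} g hz := match z, hz with
    | .inl x, hx => X.str_act x g hx
    | .inr y, hy => Y.str_act y g hy
  act_id z := match z with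
    | .inl x => congrArg Sum.inl (X.act_id x)
    | .inr y => congrArg Sum.inr (Y.act_id y)
  act_act z {_ _ _} g h hz := match z, hz with
    | .inl x, hx => congrArg Sum.inl (X.act_act x g h hx)
    | .inr y, hy => congrArg Sum.inr (Y.act_act y g h hy)

/-- The fibre product `X ×_{G₀} Y` of two right `G`-sets along their structure maps, with the
diagonal action. -/
def prod (X Y : RightGSet G) : RightGSet G where
  carrier := {p : X.carrier × Y.carrier // X.str p.1 = Y.str p.2}
  str p := X.str p.1.1
  act p {_ _} g hp := ⟨(X.act p.1.1 g hp, Y.act p.1.2 g (p.2.symm.trans hp)),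
    (X.str_act _ _ _).trans (Y.str_act _ _ _).symm⟩
  str_act _ {_ _} _ _ := X.str_act _ _ _
  act_id p := by
    obtain ⟨⟨x, y⟩, h⟩ := p
    apply Subtype.ext
    refine Prod.ext (X.act_id x) ?_
    have key : ∀ (b : G) (hb : Y.str y = b), Y.act y (𝟙 b) hb = y := by
      rintro b rfl; exact Y.act_id y
    exact key _ _
  act_act _ {_ _ _} _ _ _ := Subtype.ext (Prod.ext (X.act_act _ _ _ _) (Y.act_act _ _ _ _))

end RightGSet

/-! ## Categorified groupoid-sets: internal categories in right `G`-sets -/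

/-- A categorified `G`-set: an internal category in the category of right `G`-sets.  The
composition `comp p q h` of `p` and `q` with `s(p) = t(q)` (that is, `p ∘ q`) is a map on the
pull-back `X₁ ×_{s,t} X₁`; `str_comp` and `comp_act` say that it is `G`-equivariant for the
diagonal action `(p, q) g = (p g, q g)`. -/
structure CategorifiedGSet (G : Type u) [Groupoid.{u} G] where
  Ob : RightGSet G
  Mor : RightGSet G
  src : EquivariantMap Mor Ob
  tgt : EquivariantMap Mor Ob
  idn : EquivariantMap Ob Mor
  comp : (p q : Mor.carrier) → src.toFun p = tgt.toFun q → Mor.carrier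
  str_comp : ∀ p q h, Mor.str (comp p q h) = Mor.str p
  comp_act : ∀ (p q : Mor.carrier) (h : src.toFun p = tgt.toFun q) {a b : G} (g : a ⟶ b)
    (hp : Mor.str p = b) (hq : Mor.str q = b)
    (h' : src.toFun (Mor.act p g hp) = tgt.toFun (Mor.act q g hq)),
    Mor.act (comp p q h) g ((str_comp p q h).trans hp) =
      comp (Mor.act p g hp) (Mor.act q g hq) h'
  src_idn : ∀ x, src.toFun (idn.toFun x) = x
  tgt_idn : ∀ x, tgt.toFun (idn.toFun x) = x
  src_comp : ∀ p q h, src.toFun (comp p q h) = src.toFun q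
  tgt_comp : ∀ p q h, tgt.toFun (comp p q h) = tgt.toFun p
  comp_assoc : ∀ (p q r : Mor.carrier) (h₁ : src.toFun p = tgt.toFun q)
    (h₂ : src.toFun q = tgt.toFun r),
    comp (comp p q h₁) r ((src_comp p q h₁).trans h₂) =
      comp p (comp q r h₂) (h₁.trans (tgt_comp q r h₂).symm)
  id_comp : ∀ p, comp (idn.toFun (tgt.toFun p)) p (src_idn _) = p
  comp_id : ∀ p, comp p (idn.toFun (src.toFun p)) (tgt_idn _).symm = p

section

variable {G : Type u} [Groupoid.{u} G]

/-- A morphism of categorified `G`-sets: an internal functor. -/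
structure CatGFunctor (X Y : CategorifiedGSet G) where
  ob : EquivariantMap X.Ob Y.Ob
  mor : EquivariantMap X.Mor Y.Mor
  src_mor : ∀ p, Y.src.toFun (mor.toFun p) = ob.toFun (X.src.toFun p)
  tgt_mor : ∀ p, Y.tgt.toFun (mor.toFun p) = ob.toFun (X.tgt.toFun p)
  map_idn : ∀ x, mor.toFun (X.idn.toFun x) = Y.idn.toFun (ob.toFun x)
  map_comp : ∀ p q (h : X.src.toFun p = X.tgt.toFun q),
    mor.toFun (X.comp p q h) = Y.comp (mor.toFun p) (mor.toFun q)
      ((src_mor p).trans ((congrArg ob.toFun h).trans (tgt_mor q).symm))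

/-- A 2-morphism: an internal natural transformation, i.e. a `G`-equivariant map `X₀ → Y₁`. -/
structure CatGTrans {X Y : CategorifiedGSet G} (F K : CatGFunctor X Y) where
  app : EquivariantMap X.Ob Y.Mor
  src_app : ∀ x, Y.src.toFun (app.toFun x) = F.ob.toFun x
  tgt_app : ∀ x, Y.tgt.toFun (app.toFun x) = K.ob.toFun x
  naturality : ∀ p : X.Mor.carrier,
    Y.comp (K.mor.toFun p) (app.toFun (X.src.toFun p)) ((K.src_mor p).trans (tgt_app _).symm) =
      Y.comp (app.toFun (X.tgt.toFun p)) (F.mor.toFun p) ((src_app _).trans (F.tgt_mor p).symm)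

/-- A 2-isomorphism: an invertible 2-morphism for the vertical composition. -/
structure CatGTransIso {X Y : CategorifiedGSet G} (F K : CatGFunctor X Y) where
  hom : CatGTrans F K
  inv : CatGTrans K F
  hom_inv : ∀ x, Y.comp (inv.app.toFun x) (hom.app.toFun x)
    ((inv.src_app x).trans (hom.tgt_app x).symm) = Y.idn.toFun (F.ob.toFun x)
  inv_hom : ∀ x, Y.comp (hom.app.toFun x) (inv.app.toFun x)
    ((hom.src_app x).trans (inv.tgt_app x).symm) = Y.idn.toFun (K.ob.toFun x)

namespace EquivariantMap

/-- The identity equivariant map. -/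
def id (X : RightGSet G) : EquivariantMap X X where
  toFun x := x
  str_map _ := rfl
  map_act _ _ _ _ _ := rfl

/-- Composition of equivariant maps, in the usual order: `(f.comp g)(x) = f (g x)`. -/
def comp {X Y Z : RightGSet G} (f : EquivariantMap Y Z) (g : EquivariantMap X Y) :
    EquivariantMap X Z where
  toFun x := f.toFun (g.toFun x)
  str_map x := (f.str_map _).trans (g.str_map x)
  map_act x {_ _} k hx := by rw [g.map_act x k hx, f.map_act]

/-- The equivariant map out of the empty `G`-set. -/
def fromEmpty (X : RightGSet G) : EquivariantMap (RightGSet.empty G) X where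
  toFun x := x.elim
  str_map x := x.elim
  map_act x := x.elim

/-- The equivariant map `X → Z` from the sum given by two equivariant maps. -/
def sumElim {X Y Z : RightGSet G} (f : EquivariantMap X Z) (g : EquivariantMap Y Z) :
    EquivariantMap (X.sum Y) Z where
  toFun := Sum.elim f.toFun g.toFun
  str_map z := match z with
    | .inl x => f.str_map x
    | .inr y => g.str_map y
  map_act z {_ _} k hz := match z, hz with
    | .inl x, hx => f.map_act x k hx
    | .inr y, hy => g.map_act y k hy

/-- The left inclusion into the disjoint union. -/
def inl (X Y : RightGSet G) : EquivariantMap X (X.sum Y) where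
  toFun := Sum.inl
  str_map _ := rfl
  map_act _ _ _ _ _ := rfl

/-- The right inclusion into the disjoint union. -/
def inr (X Y : RightGSet G) : EquivariantMap Y (X.sum Y) where
  toFun := Sum.inr
  str_map _ := rfl
  map_act _ _ _ _ _ := rfl

/-- The disjoint union `f ⊎ g` of two equivariant maps. -/
def sumMap {X Y X' Y' : RightGSet G} (f : EquivariantMap X X') (g : EquivariantMap Y Y') :
    EquivariantMap (X.sum Y) (X'.sum Y') :=
  sumElim ((inl X' Y').comp f) ((inr X' Y').comp g)

/-- The map into a fibre product given by two equivariant maps. -/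
def prodLift {X Y Z : RightGSet G} (f : EquivariantMap Z X) (g : EquivariantMap Z Y) :
    EquivariantMap Z (X.prod Y) where
  toFun z := ⟨(f.toFun z, g.toFun z), (f.str_map z).trans (g.str_map z).symm⟩
  str_map z := f.str_map z
  map_act z {_ _} k hz := Subtype.ext (Prod.ext (f.map_act z k hz) (g.map_act z k hz))

/-- The first projection of a fibre product. -/
def fst (X Y : RightGSet G) : EquivariantMap (X.prod Y) X where
  toFun p := p.1.1
  str_map _ := rfl
  map_act _ _ _ _ _ := rfl

/-- The second projection of a fibre product. -/
def snd (X Y : RightGSet G) : EquivariantMap (X.prod Y) Y where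
  toFun p := p.1.2
  str_map p := p.2.symm
  map_act _ _ _ _ _ := rfl

/-- The fibre product `f × g` of two equivariant maps. -/
def prodMap {X Y X' Y' : RightGSet G} (f : EquivariantMap X X') (g : EquivariantMap Y Y') :
    EquivariantMap (X.prod Y) (X'.prod Y') :=
  prodLift (f.comp (fst X Y)) (g.comp (snd X Y))

/-- The distributivity map `(X ⊎ Y) ×_{G₀} A → (X ×_{G₀} A) ⊎ (Y ×_{G₀} A)`. -/
def distrib (X Y A : RightGSet G) :
    EquivariantMap ((X.sum Y).prod A) ((X.prod A).sum (Y.prod A)) where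
  toFun p := match p with
    | ⟨(.inl x, a), h⟩ => .inl ⟨(x, a), h⟩
    | ⟨(.inr y, a), h⟩ => .inr ⟨(y, a), h⟩
  str_map p := match p with
    | ⟨(.inl _, _), _⟩ => rfl
    | ⟨(.inr _, _), _⟩ => rfl
  map_act p {_ _} _ _ := match p with
    | ⟨(.inl _, _), _⟩ => rfl
    | ⟨(.inr _, _), _⟩ => rfl

end EquivariantMap

namespace CatGFunctor

/-- The identity functor. -/
def id (X : CategorifiedGSet G) : CatGFunctor X X where
  ob := .id X.Ob
  mor := .id X.Mor
  src_mor _ := rfl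
  tgt_mor _ := rfl
  map_idn _ := rfl
  map_comp _ _ _ := rfl

/-- Composition of functors, in the usual order: first `K`, then `F`. -/
def comp {X Y Z : CategorifiedGSet G} (F : CatGFunctor Y Z) (K : CatGFunctor X Y) :
    CatGFunctor X Z where
  ob := F.ob.comp K.ob
  mor := F.mor.comp K.mor
  src_mor p := (F.src_mor _).trans (congrArg F.ob.toFun (K.src_mor p))
  tgt_mor p := (F.tgt_mor _).trans (congrArg F.ob.toFun (K.tgt_mor p))
  map_idn x := (congrArg F.mor.toFun (K.map_idn x)).trans (F.map_idn _)
  map_comp p q h := (congrArg F.mor.toFun (K.map_comp p q h)).trans (F.map_comp _ _ _)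

end CatGFunctor

/-- Two categorified `G`-sets are weakly equivalent if there are morphisms `φ : X → Y` and
`ψ : Y → X` and 2-isomorphisms `ψ φ ≅ Id` and `φ ψ ≅ Id`. -/
def WeaklyEquivalent (X Y : CategorifiedGSet G) : Prop :=
  ∃ (φ : CatGFunctor X Y) (ψ : CatGFunctor Y X),
    Nonempty (CatGTransIso (ψ.comp φ) (CatGFunctor.id X)) ∧
    Nonempty (CatGTransIso (φ.comp ψ) (CatGFunctor.id Y))

namespace CategorifiedGSet

theorem comp_congr (X : CategorifiedGSet G) {p p' q q' : X.Mor.carrier} (hp : p = p') (hq : q = q')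
    (h : X.src.toFun p = X.tgt.toFun q) (h' : X.src.toFun p' = X.tgt.toFun q') :
    X.comp p q h = X.comp p' q' h' := by
  subst hp hq; rfl

theorem id_comp' (X : CategorifiedGSet G) {p : X.Mor.carrier} {x : X.Ob.carrier}
    (h : X.src.toFun (X.idn.toFun x) = X.tgt.toFun p) : X.comp (X.idn.toFun x) p h = p := by
  rw [X.src_idn] at h; subst h; exact X.id_comp p

theorem comp_id' (X : CategorifiedGSet G) {p : X.Mor.carrier} {x : X.Ob.carrier}
    (h : X.src.toFun p = X.tgt.toFun (X.idn.toFun x)) : X.comp p (X.idn.toFun x) h = p := by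
  rw [X.tgt_idn] at h; subst h; exact X.comp_id p

end CategorifiedGSet

namespace CatGTransIso

variable {X Y Z : CategorifiedGSet G}

/-- A 2-isomorphism between functors which agree on objects and on arrows. -/
def ofEq {F K : CatGFunctor X Y} (h₀ : ∀ x, F.ob.toFun x = K.ob.toFun x)
    (h₁ : ∀ p, F.mor.toFun p = K.mor.toFun p) : CatGTransIso F K where
  hom :=
    { app := Y.idn.comp F.ob
      src_app := fun _ => Y.src_idn _
      tgt_app := fun x => (Y.tgt_idn _).trans (h₀ x)
      naturality := fun p =>
        ((Y.comp_id' _).trans (h₁ p).symm).trans (Y.id_comp' _).symm }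
  inv :=
    { app := Y.idn.comp F.ob
      src_app := fun x => (Y.src_idn _).trans (h₀ x)
      tgt_app := fun _ => Y.tgt_idn _
      naturality := fun p => ((Y.comp_id' _).trans (h₁ p)).trans (Y.id_comp' _).symm }
  hom_inv _ := Y.comp_id' _
  inv_hom x := (Y.comp_id' _).trans (congrArg Y.idn.toFun (h₀ x))

/-- The inverse of a 2-isomorphism. -/
def symm {F K : CatGFunctor X Y} (α : CatGTransIso F K) : CatGTransIso K F :=
  ⟨α.inv, α.hom, α.inv_hom, α.hom_inv⟩

end CatGTransIso

/-- Vertical composition of 2-morphisms. -/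
def CatGTrans.vcomp {X Y : CategorifiedGSet G} {F K L : CatGFunctor X Y} (β : CatGTrans K L)
    (α : CatGTrans F K) : CatGTrans F L where
  app :=
    { toFun := fun x => Y.comp (β.app.toFun x) (α.app.toFun x)
        ((β.src_app x).trans (α.tgt_app x).symm)
      str_map := fun x => (Y.str_comp _ _ _).trans (β.app.str_map x)
      map_act := fun x {_ _} g hx => by
        rw [Y.comp_act _ _ _ g ((β.app.str_map x).trans hx) ((α.app.str_map x).trans hx)]
        · exact Y.comp_congr (β.app.map_act x g hx) (α.app.map_act x g hx) _ _
        · rw [← β.app.map_act x g hx, ← α.app.map_act x g hx, β.src_app, α.tgt_app] }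
  src_app x := (Y.src_comp _ _ _).trans (α.src_app x)
  tgt_app x := (Y.tgt_comp _ _ _).trans (β.tgt_app x)
  naturality p := by
    dsimp only
    rw [← Y.comp_assoc _ _ _ ((L.src_mor p).trans (β.tgt_app _).symm),
      Y.comp_congr (β.naturality p) rfl _
        (((Y.src_comp _ _ _).trans (K.src_mor p)).trans (α.tgt_app _).symm),
      Y.comp_assoc _ _ _ _ ((K.src_mor p).trans (α.tgt_app _).symm),
      Y.comp_congr rfl (α.naturality p) _
        (((β.src_app _).trans (α.tgt_app _).symm).trans (Y.tgt_comp _ _ _).symm),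
      ← Y.comp_assoc _ _ _ ((β.src_app _).trans (α.tgt_app _).symm)]

/-- Whiskering of a 2-morphism by a functor on either side. -/
def CatGTrans.whisker {W X Y Z : CategorifiedGSet G} {F K : CatGFunctor X Y} (P : CatGFunctor Y Z)
    (α : CatGTrans F K) (Q : CatGFunctor W X) :
    CatGTrans (P.comp (F.comp Q)) (P.comp (K.comp Q)) where
  app := P.mor.comp (α.app.comp Q.ob)
  src_app x := (P.src_mor _).trans (congrArg P.ob.toFun (α.src_app _))
  tgt_app x := (P.tgt_mor _).trans (congrArg P.ob.toFun (α.tgt_app _))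
  naturality p := by
    have h := congrArg P.mor.toFun (α.naturality (Q.mor.toFun p))
    rw [P.map_comp, P.map_comp] at h
    refine Eq.trans (Z.comp_congr rfl ?_ _ _) (h.trans (Z.comp_congr ?_ rfl _ _))
    · exact congrArg (fun x => P.mor.toFun (α.app.toFun x)) (Q.src_mor p).symm
    · exact congrArg (fun x => P.mor.toFun (α.app.toFun x)) (Q.tgt_mor p)

namespace CatGTransIso

variable {W X Y Z : CategorifiedGSet G}

/-- Vertical composition of 2-isomorphisms. -/
def trans {F K L : CatGFunctor X Y} (α : CatGTransIso F K) (β : CatGTransIso K L) :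
    CatGTransIso F L where
  hom := β.hom.vcomp α.hom
  inv := α.inv.vcomp β.inv
  hom_inv x := by
    dsimp only [CatGTrans.vcomp]
    have e : Y.src.toFun (β.inv.app.toFun x) = Y.tgt.toFun (β.hom.app.toFun x) :=
      (β.inv.src_app x).trans (β.hom.tgt_app x).symm
    rw [Y.comp_assoc _ _ _ _ (e.trans (Y.tgt_comp _ _ _).symm)]
    refine (Y.comp_congr rfl ?_ _ ?_).trans (α.hom_inv x)
    · rw [← Y.comp_assoc _ _ _ e, Y.comp_congr (β.hom_inv x) rfl _
        ((Y.src_idn _).trans (α.hom.tgt_app x).symm)]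
      exact Y.id_comp' _
    · exact (α.inv.src_app x).trans (α.hom.tgt_app x).symm
  inv_hom x := by
    dsimp only [CatGTrans.vcomp]
    have e : Y.src.toFun (α.hom.app.toFun x) = Y.tgt.toFun (α.inv.app.toFun x) :=
      (α.hom.src_app x).trans (α.inv.tgt_app x).symm
    rw [Y.comp_assoc _ _ _ _ (e.trans (Y.tgt_comp _ _ _).symm)]
    refine (Y.comp_congr rfl ?_ _ ?_).trans (β.inv_hom x)
    · rw [← Y.comp_assoc _ _ _ e, Y.comp_congr (α.inv_hom x) rfl _
        ((Y.src_idn _).trans (β.inv.tgt_app x).symm)]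
      exact Y.id_comp' _
    · exact (β.hom.src_app x).trans (β.inv.tgt_app x).symm

/-- Whiskering of a 2-isomorphism by a functor on either side. -/
def whisker {F K : CatGFunctor X Y} (P : CatGFunctor Y Z) (α : CatGTransIso F K)
    (Q : CatGFunctor W X) : CatGTransIso (P.comp (F.comp Q)) (P.comp (K.comp Q)) where
  hom := α.hom.whisker P Q
  inv := α.inv.whisker P Q
  hom_inv x := by
    have h := congrArg P.mor.toFun (α.hom_inv (Q.ob.toFun x))
    rw [P.map_comp, P.map_idn] at h
    exact h
  inv_hom x := by
    have h := congrArg P.mor.toFun (α.inv_hom (Q.ob.toFun x))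
    rw [P.map_comp, P.map_idn] at h
    exact h

end CatGTransIso

namespace WeaklyEquivalent

variable {X Y Z : CategorifiedGSet G}

/-- Isomorphic categorified `G`-sets are weakly equivalent. -/
theorem of_iso (φ : CatGFunctor X Y) (ψ : CatGFunctor Y X)
    (h₀ : ∀ x, ψ.ob.toFun (φ.ob.toFun x) = x) (h₁ : ∀ p, ψ.mor.toFun (φ.mor.toFun p) = p)
    (k₀ : ∀ y, φ.ob.toFun (ψ.ob.toFun y) = y) (k₁ : ∀ q, φ.mor.toFun (ψ.mor.toFun q) = q) :
    WeaklyEquivalent X Y :=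
  ⟨φ, ψ, ⟨.ofEq h₀ h₁⟩, ⟨.ofEq k₀ k₁⟩⟩

theorem refl (X : CategorifiedGSet G) : WeaklyEquivalent X X :=
  of_iso (.id X) (.id X) (fun _ => rfl) (fun _ => rfl) (fun _ => rfl) (fun _ => rfl)

theorem symm (h : WeaklyEquivalent X Y) : WeaklyEquivalent Y X :=
  let ⟨φ, ψ, α, β⟩ := h
  ⟨ψ, φ, β, α⟩

theorem trans (h : WeaklyEquivalent X Y) (k : WeaklyEquivalent Y Z) : WeaklyEquivalent X Z := by
  obtain ⟨φ, ψ, ⟨α⟩, ⟨β⟩⟩ := h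
  obtain ⟨φ', ψ', ⟨α'⟩, ⟨β'⟩⟩ := k
  exact ⟨φ'.comp φ, ψ.comp ψ', ⟨(α'.whisker ψ φ).trans α⟩, ⟨(β.whisker φ' ψ').trans β'⟩⟩

end WeaklyEquivalent

/-! ## Disjoint union and fibre product of categorified groupoid-sets -/

namespace CategorifiedGSet

/-- The discrete categorified `G`-set on a right `G`-set. -/
def discrete (X : RightGSet G) : CategorifiedGSet G where
  Ob := X
  Mor := X
  src := .id X
  tgt := .id X
  idn := .id X
  comp p _ _ := p
  str_comp _ _ _ := rfl
  comp_act _ _ _ _ _ _ _ _ _ := rfl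
  src_idn _ := rfl
  tgt_idn _ := rfl
  src_comp _ _ h := h
  tgt_comp _ _ _ := rfl
  comp_assoc _ _ _ _ _ := rfl
  id_comp _ := rfl
  comp_id _ := rfl

/-- The disjoint union `X ⊎ Y` of two categorified `G`-sets. -/
def sum (X Y : CategorifiedGSet G) : CategorifiedGSet G where
  Ob := X.Ob.sum Y.Ob
  Mor := X.Mor.sum Y.Mor
  src := X.src.sumMap Y.src
  tgt := X.tgt.sumMap Y.tgt
  idn := X.idn.sumMap Y.idn
  comp p q h := match p, q, h with
    | .inl p, .inl q, h => .inl (X.comp p q (Sum.inl_injective h))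
    | .inr p, .inr q, h => .inr (Y.comp p q (Sum.inr_injective h))
    | .inl _, .inr _, h => (Sum.inl_ne_inr h).elim
    | .inr _, .inl _, h => (Sum.inr_ne_inl h).elim
  str_comp p q h := match p, q, h with
    | .inl p, .inl q, h => X.str_comp p q (Sum.inl_injective h)
    | .inr p, .inr q, h => Y.str_comp p q (Sum.inr_injective h)
    | .inl _, .inr _, h => (Sum.inl_ne_inr h).elim
    | .inr _, .inl _, h => (Sum.inr_ne_inl h).elim
  comp_act p q h {_ _} g hp hq h' := match p, q, h, hp, hq, h' with
    | .inl p, .inl q, h, hp, hq, h' =>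
      congrArg Sum.inl (X.comp_act p q (Sum.inl_injective h) g hp hq (Sum.inl_injective h'))
    | .inr p, .inr q, h, hp, hq, h' =>
      congrArg Sum.inr (Y.comp_act p q (Sum.inr_injective h) g hp hq (Sum.inr_injective h'))
    | .inl _, .inr _, h, _, _, _ => (Sum.inl_ne_inr h).elim
    | .inr _, .inl _, h, _, _, _ => (Sum.inr_ne_inl h).elim
  src_idn x := match x with
    | .inl x => congrArg Sum.inl (X.src_idn x)
    | .inr x => congrArg Sum.inr (Y.src_idn x)
  tgt_idn x := match x with
    | .inl x => congrArg Sum.inl (X.tgt_idn x)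
    | .inr x => congrArg Sum.inr (Y.tgt_idn x)
  src_comp p q h := match p, q, h with
    | .inl p, .inl q, h => congrArg Sum.inl (X.src_comp p q (Sum.inl_injective h))
    | .inr p, .inr q, h => congrArg Sum.inr (Y.src_comp p q (Sum.inr_injective h))
    | .inl _, .inr _, h => (Sum.inl_ne_inr h).elim
    | .inr _, .inl _, h => (Sum.inr_ne_inl h).elim
  tgt_comp p q h := match p, q, h with
    | .inl p, .inl q, h => congrArg Sum.inl (X.tgt_comp p q (Sum.inl_injective h))
    | .inr p, .inr q, h => congrArg Sum.inr (Y.tgt_comp p q (Sum.inr_injective h))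
    | .inl _, .inr _, h => (Sum.inl_ne_inr h).elim
    | .inr _, .inl _, h => (Sum.inr_ne_inl h).elim
  comp_assoc p q r h₁ h₂ := match p, q, r, h₁, h₂ with
    | .inl p, .inl q, .inl r, h₁, h₂ =>
      congrArg Sum.inl (X.comp_assoc p q r (Sum.inl_injective h₁) (Sum.inl_injective h₂))
    | .inr p, .inr q, .inr r, h₁, h₂ =>
      congrArg Sum.inr (Y.comp_assoc p q r (Sum.inr_injective h₁) (Sum.inr_injective h₂))
    | .inl _, .inr _, _, h, _ => (Sum.inl_ne_inr h).elim
    | .inr _, .inl _, _, h, _ => (Sum.inr_ne_inl h).elim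
    | .inl _, .inl _, .inr _, _, h => (Sum.inl_ne_inr h).elim
    | .inr _, .inr _, .inl _, _, h => (Sum.inr_ne_inl h).elim
  id_comp p := match p with
    | .inl p => congrArg Sum.inl (X.id_comp p)
    | .inr p => congrArg Sum.inr (Y.id_comp p)
  comp_id p := match p with
    | .inl p => congrArg Sum.inl (X.comp_id p)
    | .inr p => congrArg Sum.inr (Y.comp_id p)

/-- The fibre product `X ×_{G₀} Y` of two categorified `G`-sets. -/
def prod (X Y : CategorifiedGSet G) : CategorifiedGSet G where
  Ob := X.Ob.prod Y.Ob
  Mor := X.Mor.prod Y.Mor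
  src := X.src.prodMap Y.src
  tgt := X.tgt.prodMap Y.tgt
  idn := X.idn.prodMap Y.idn
  comp p q h :=
    ⟨(X.comp p.1.1 q.1.1 (congrArg (fun z => z.1.1) h),
      Y.comp p.1.2 q.1.2 (congrArg (fun z => z.1.2) h)),
      (X.str_comp _ _ _).trans (p.2.trans (Y.str_comp _ _ _).symm)⟩
  str_comp _ _ _ := X.str_comp _ _ _
  comp_act _ _ _ {_ _} _ _ _ h' := Subtype.ext (Prod.ext
    (X.comp_act _ _ _ _ _ _ (congrArg (fun z => z.1.1) h'))
    (Y.comp_act _ _ _ _ _ _ (congrArg (fun z => z.1.2) h')))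
  src_idn _ := Subtype.ext (Prod.ext (X.src_idn _) (Y.src_idn _))
  tgt_idn _ := Subtype.ext (Prod.ext (X.tgt_idn _) (Y.tgt_idn _))
  src_comp _ _ _ := Subtype.ext (Prod.ext (X.src_comp _ _ _) (Y.src_comp _ _ _))
  tgt_comp _ _ _ := Subtype.ext (Prod.ext (X.tgt_comp _ _ _) (Y.tgt_comp _ _ _))
  comp_assoc _ _ _ h₁ h₂ := Subtype.ext (Prod.ext
    (X.comp_assoc _ _ _ (congrArg (fun z => z.1.1) h₁) (congrArg (fun z => z.1.1) h₂))
    (Y.comp_assoc _ _ _ (congrArg (fun z => z.1.2) h₁) (congrArg (fun z => z.1.2) h₂)))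
  id_comp _ := Subtype.ext (Prod.ext (X.id_comp _) (Y.id_comp _))
  comp_id _ := Subtype.ext (Prod.ext (X.comp_id _) (Y.comp_id _))

end CategorifiedGSet

namespace CatGFunctor

variable {X Y X' Y' Z : CategorifiedGSet G}

/-- The functor out of a disjoint union given by two functors. -/
def sumElim (F : CatGFunctor X Z) (K : CatGFunctor Y Z) : CatGFunctor (X.sum Y) Z where
  ob := F.ob.sumElim K.ob
  mor := F.mor.sumElim K.mor
  src_mor p := match p with
    | .inl p => F.src_mor p
    | .inr p => K.src_mor p
  tgt_mor p := match p with
    | .inl p => F.tgt_mor p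
    | .inr p => K.tgt_mor p
  map_idn p := match p with
    | .inl p => F.map_idn p
    | .inr p => K.map_idn p
  map_comp p q h := match p, q, h with
    | .inl p, .inl q, h => F.map_comp p q (Sum.inl_injective h)
    | .inr p, .inr q, h => K.map_comp p q (Sum.inr_injective h)
    | .inl _, .inr _, h => (Sum.inl_ne_inr h).elim
    | .inr _, .inl _, h => (Sum.inr_ne_inl h).elim

/-- The left inclusion functor. -/
def inl (X Y : CategorifiedGSet G) : CatGFunctor X (X.sum Y) where
  ob := .inl _ _
  mor := .inl _ _
  src_mor _ := rfl
  tgt_mor _ := rfl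
  map_idn _ := rfl
  map_comp _ _ _ := rfl

/-- The right inclusion functor. -/
def inr (X Y : CategorifiedGSet G) : CatGFunctor Y (X.sum Y) where
  ob := .inr _ _
  mor := .inr _ _
  src_mor _ := rfl
  tgt_mor _ := rfl
  map_idn _ := rfl
  map_comp _ _ _ := rfl

/-- The disjoint union of two functors. -/
def sumMap (F : CatGFunctor X X') (K : CatGFunctor Y Y') : CatGFunctor (X.sum Y) (X'.sum Y') :=
  sumElim ((inl X' Y').comp F) ((inr X' Y').comp K)

/-- The functor into a fibre product given by two functors. -/
def prodLift (F : CatGFunctor Z X) (K : CatGFunctor Z Y) : CatGFunctor Z (X.prod Y) where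
  ob := F.ob.prodLift K.ob
  mor := F.mor.prodLift K.mor
  src_mor _ := Subtype.ext (Prod.ext (F.src_mor _) (K.src_mor _))
  tgt_mor _ := Subtype.ext (Prod.ext (F.tgt_mor _) (K.tgt_mor _))
  map_idn _ := Subtype.ext (Prod.ext (F.map_idn _) (K.map_idn _))
  map_comp _ _ _ := Subtype.ext (Prod.ext (F.map_comp _ _ _) (K.map_comp _ _ _))

/-- The first projection functor. -/
def fst (X Y : CategorifiedGSet G) : CatGFunctor (X.prod Y) X where
  ob := .fst _ _
  mor := .fst _ _
  src_mor _ := rfl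
  tgt_mor _ := rfl
  map_idn _ := rfl
  map_comp _ _ _ := rfl

/-- The second projection functor. -/
def snd (X Y : CategorifiedGSet G) : CatGFunctor (X.prod Y) Y where
  ob := .snd _ _
  mor := .snd _ _
  src_mor _ := rfl
  tgt_mor _ := rfl
  map_idn _ := rfl
  map_comp _ _ _ := rfl

/-- The fibre product of two functors. -/
def prodMap (F : CatGFunctor X X') (K : CatGFunctor Y Y') :
    CatGFunctor (X.prod Y) (X'.prod Y') :=
  prodLift (F.comp (fst X Y)) (K.comp (snd X Y))

/-- The functor out of the empty categorified `G`-set. -/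
def fromEmpty (X : CategorifiedGSet G) :
    CatGFunctor (CategorifiedGSet.discrete (RightGSet.empty G)) X where
  ob := .fromEmpty _
  mor := .fromEmpty _
  src_mor p := p.elim
  tgt_mor p := p.elim
  map_idn p := p.elim
  map_comp p := p.elim

/-- The distributivity functor `(X ⊎ Y) ×_{G₀} A → (X ×_{G₀} A) ⊎ (Y ×_{G₀} A)`. -/
def distrib (X Y A : CategorifiedGSet G) :
    CatGFunctor ((X.sum Y).prod A) ((X.prod A).sum (Y.prod A)) where
  ob := .distrib _ _ _
  mor := .distrib _ _ _
  src_mor p := match p with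
    | ⟨(.inl _, _), _⟩ => rfl
    | ⟨(.inr _, _), _⟩ => rfl
  tgt_mor p := match p with
    | ⟨(.inl _, _), _⟩ => rfl
    | ⟨(.inr _, _), _⟩ => rfl
  map_idn p := match p with
    | ⟨(.inl _, _), _⟩ => rfl
    | ⟨(.inr _, _), _⟩ => rfl
  map_comp p q h := match p, q, h with
    | ⟨(.inl _, _), _⟩, ⟨(.inl _, _), _⟩, _ => rfl
    | ⟨(.inr _, _), _⟩, ⟨(.inr _, _), _⟩, _ => rfl
    | ⟨(.inl _, _), _⟩, ⟨(.inr _, _), _⟩, h =>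
      (Sum.inl_ne_inr (congrArg (fun z => z.1.1) h)).elim
    | ⟨(.inr _, _), _⟩, ⟨(.inl _, _), _⟩, h =>
      (Sum.inr_ne_inl (congrArg (fun z => z.1.1) h)).elim

/-- The structure functor to the discrete categorified `G`-set `G₀`. -/
def toBase (X : CategorifiedGSet G) :
    CatGFunctor X (CategorifiedGSet.discrete (RightGSet.base G)) where
  ob := ⟨X.Ob.str, fun _ => rfl, fun _ _ _ _ _ => X.Ob.str_act _ _ _⟩
  mor := ⟨X.Mor.str, fun _ => rfl, fun _ _ _ _ _ => X.Mor.str_act _ _ _⟩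
  src_mor p := (X.src.str_map p).symm
  tgt_mor p := (X.tgt.str_map p).symm
  map_idn x := X.idn.str_map x
  map_comp _ _ _ := X.str_comp _ _ _

end CatGFunctor

namespace WeaklyEquivalent

variable {X Y X' Y' : CategorifiedGSet G}

/-- The disjoint union of two 2-morphisms between endofunctors, the targets being identities. -/
theorem sum_aux {F K : CatGFunctor X X} {F' K' : CatGFunctor Y Y}
    {P Q : CatGFunctor (X.sum Y) (X.sum Y)} (α : CatGTransIso F K) (β : CatGTransIso F' K')
    (hP₀ : P.ob.toFun = (F.sumMap F').ob.toFun) (hP₁ : P.mor.toFun = (F.sumMap F').mor.toFun)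
    (hQ₀ : Q.ob.toFun = (K.sumMap K').ob.toFun) (hQ₁ : Q.mor.toFun = (K.sumMap K').mor.toFun) :
    Nonempty (CatGTransIso P Q) := by
  have γ : CatGTransIso (F.sumMap F') (K.sumMap K') :=
    { hom :=
        { app := α.hom.app.sumMap β.hom.app
          src_app := fun x => match x with
            | .inl x => congrArg Sum.inl (α.hom.src_app x)
            | .inr x => congrArg Sum.inr (β.hom.src_app x)
          tgt_app := fun x => match x with
            | .inl x => congrArg Sum.inl (α.hom.tgt_app x)
            | .inr x => congrArg Sum.inr (β.hom.tgt_app x)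
          naturality := fun p => match p with
            | .inl p => congrArg Sum.inl (α.hom.naturality p)
            | .inr p => congrArg Sum.inr (β.hom.naturality p) }
      inv :=
        { app := α.inv.app.sumMap β.inv.app
          src_app := fun x => match x with
            | .inl x => congrArg Sum.inl (α.inv.src_app x)
            | .inr x => congrArg Sum.inr (β.inv.src_app x)
          tgt_app := fun x => match x with
            | .inl x => congrArg Sum.inl (α.inv.tgt_app x)
            | .inr x => congrArg Sum.inr (β.inv.tgt_app x)
          naturality := fun p => match p with
            | .inl p => congrArg Sum.inl (α.inv.naturality p)
            | .inr p => congrArg Sum.inr (β.inv.naturality p) }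
      hom_inv := fun x => match x with
        | .inl x => congrArg Sum.inl (α.hom_inv x)
        | .inr x => congrArg Sum.inr (β.hom_inv x)
      inv_hom := fun x => match x with
        | .inl x => congrArg Sum.inl (α.inv_hom x)
        | .inr x => congrArg Sum.inr (β.inv_hom x) }
  exact ⟨((CatGTransIso.ofEq (congrFun hP₀) (congrFun hP₁)).trans γ).trans
    (CatGTransIso.ofEq (congrFun hQ₀) (congrFun hQ₁)).symm⟩

/-- The disjoint union preserves weak equivalences. -/
theorem sum (h : WeaklyEquivalent X X') (k : WeaklyEquivalent Y Y') :
    WeaklyEquivalent (X.sum Y) (X'.sum Y') := by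
  obtain ⟨φ, ψ, ⟨α⟩, ⟨β⟩⟩ := h
  obtain ⟨φ', ψ', ⟨α'⟩, ⟨β'⟩⟩ := k
  refine ⟨φ.sumMap φ', ψ.sumMap ψ', sum_aux α α' ?_ ?_ ?_ ?_, sum_aux β β' ?_ ?_ ?_ ?_⟩ <;>
    (funext z; cases z <;> rfl)

/-- The fibre product preserves weak equivalences. -/
theorem prod (h : WeaklyEquivalent X X') (k : WeaklyEquivalent Y Y') :
    WeaklyEquivalent (X.prod Y) (X'.prod Y') := by
  have aux : ∀ {X Y : CategorifiedGSet G} {F K : CatGFunctor X X} {F' K' : CatGFunctor Y Y}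
      (_ : CatGTransIso F K) (_ : CatGTransIso F' K'),
      Nonempty (CatGTransIso (F.prodMap F') (K.prodMap K')) := by
    intro X Y F K F' K' α β
    exact ⟨{
      hom :=
        { app := α.hom.app.prodMap β.hom.app
          src_app := fun _ => Subtype.ext (Prod.ext (α.hom.src_app _) (β.hom.src_app _))
          tgt_app := fun _ => Subtype.ext (Prod.ext (α.hom.tgt_app _) (β.hom.tgt_app _))
          naturality := fun _ =>
            Subtype.ext (Prod.ext (α.hom.naturality _) (β.hom.naturality _)) }
      inv :=
        { app := α.inv.app.prodMap β.inv.app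
          src_app := fun _ => Subtype.ext (Prod.ext (α.inv.src_app _) (β.inv.src_app _))
          tgt_app := fun _ => Subtype.ext (Prod.ext (α.inv.tgt_app _) (β.inv.tgt_app _))
          naturality := fun _ =>
            Subtype.ext (Prod.ext (α.inv.naturality _) (β.inv.naturality _)) }
      hom_inv := fun _ => Subtype.ext (Prod.ext (α.hom_inv _) (β.hom_inv _))
      inv_hom := fun _ => Subtype.ext (Prod.ext (α.inv_hom _) (β.inv_hom _)) }⟩
  obtain ⟨φ, ψ, ⟨α⟩, ⟨β⟩⟩ := h
  obtain ⟨φ', ψ', ⟨α'⟩, ⟨β'⟩⟩ := k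
  exact ⟨φ.prodMap φ', ψ.prodMap ψ', aux α α', aux β β'⟩

end WeaklyEquivalent

/-! ## Finite categorified groupoid-sets and the categorified Burnside rig -/

/-- A categorified `G`-set is finite if its set of arrows has finite fibres over `G₀`; its set of
objects, which embeds in the set of arrows over `G₀`, then has finite fibres too.  When `G` has
finitely many objects, in particular for a group, this says that the set of arrows is finite. -/
def CategorifiedGSet.IsFinite (X : CategorifiedGSet G) : Prop :=
  ∀ a : G, {p : X.Mor.carrier | X.Mor.str p = a}.Finite

namespace CategorifiedGSet.IsFinite

variable {X Y : CategorifiedGSet G}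

theorem sum (hX : X.IsFinite) (hY : Y.IsFinite) : (X.sum Y).IsFinite := by
  intro a
  refine (((hX a).image Sum.inl).union ((hY a).image Sum.inr)).subset ?_
  rintro (p | p) hp
  · exact Or.inl ⟨p, hp, rfl⟩
  · exact Or.inr ⟨p, hp, rfl⟩

theorem prod (hX : X.IsFinite) (hY : Y.IsFinite) : (X.prod Y).IsFinite := by
  intro a
  refine Set.Finite.of_finite_image (((hX a).prod (hY a)).subset ?_)
    (Subtype.val_injective.injOn)
  rintro _ ⟨p, hp, rfl⟩
  exact ⟨hp, p.2.symm.trans hp⟩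

end CategorifiedGSet.IsFinite

/-- Finite categorified `G`-sets. -/
def FiniteCategorifiedGSet (G : Type u) [Groupoid.{u} G] : Type (u + 1) :=
  {X : CategorifiedGSet G // X.IsFinite}

/-- Weak equivalence of finite categorified `G`-sets. -/
instance FiniteCategorifiedGSet.setoid (G : Type u) [Groupoid.{u} G] :
    Setoid (FiniteCategorifiedGSet G) where
  r X Y := WeaklyEquivalent X.1 Y.1
  iseqv := ⟨fun X => .refl X.1, fun h => h.symm, fun h k => h.trans k⟩

/-- The categorified Burnside rig of `G`: finite categorified `G`-sets up to weak equivalence. -/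
def CategorifiedBurnsideRig (G : Type u) [Groupoid.{u} G] : Type (u + 1) :=
  Quotient (FiniteCategorifiedGSet.setoid G)

namespace CategorifiedBurnsideRig

/-- The class of a finite categorified `G`-set. -/
def mk (X : CategorifiedGSet G) (hX : X.IsFinite) : CategorifiedBurnsideRig G :=
  Quotient.mk (FiniteCategorifiedGSet.setoid G) ⟨X, hX⟩

theorem sound {X Y : CategorifiedGSet G} {hX : X.IsFinite} {hY : Y.IsFinite}
    (h : WeaklyEquivalent X Y) : mk X hX = mk Y hY :=
  Quotient.sound (s := FiniteCategorifiedGSet.setoid G) h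

theorem ind {P : CategorifiedBurnsideRig G → Prop} (h : ∀ X hX, P (mk X hX))
    (x : CategorifiedBurnsideRig G) : P x :=
  Quotient.ind (fun X => h X.1 X.2) x

/-- `0` is the class of the empty categorified `G`-set. -/
instance : Zero (CategorifiedBurnsideRig G) :=
  ⟨mk (.discrete (.empty G)) fun _ => Set.Finite.subset Set.finite_empty fun p _ => p.elim⟩

/-- `1` is the class of the discrete categorified `G`-set `G₀`. -/
instance : One (CategorifiedBurnsideRig G) :=
  ⟨mk (.discrete (.base G)) fun a => Set.finite_singleton a⟩

/-- The sum is induced by the disjoint union. -/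
instance : Add (CategorifiedBurnsideRig G) :=
  ⟨Quotient.map₂ (fun X Y => ⟨X.1.sum Y.1, X.2.sum Y.2⟩) fun _ _ h _ _ k => h.sum k⟩

/-- The product is induced by the fibre product over `G₀`. -/
instance : Mul (CategorifiedBurnsideRig G) :=
  ⟨Quotient.map₂ (fun X Y => ⟨X.1.prod Y.1, X.2.prod Y.2⟩) fun _ _ h _ _ k => h.prod k⟩

open CatGFunctor in
protected theorem add_mul (a b c : CategorifiedBurnsideRig G) :
    (a + b) * c = a * c + b * c := by
  induction a using ind; induction b using ind; induction c using ind
  refine sound (.of_iso (distrib _ _ _)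
    (sumElim (prodMap (inl _ _) (.id _)) (prodMap (inr _ _) (.id _))) ?_ ?_ ?_ ?_)
  · rintro ⟨⟨_ | _, _⟩, _⟩ <;> rfl
  · rintro ⟨⟨_ | _, _⟩, _⟩ <;> rfl
  · rintro (_ | _) <;> rfl
  · rintro (_ | _) <;> rfl

open CatGFunctor in
protected theorem mul_comm (a b : CategorifiedBurnsideRig G) : a * b = b * a := by
  induction a using ind; induction b using ind
  exact sound (.of_iso (prodLift (snd _ _) (fst _ _)) (prodLift (snd _ _) (fst _ _))
    (fun _ => rfl) (fun _ => rfl) (fun _ => rfl) (fun _ => rfl))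

open CatGFunctor in
/-- The rig structure of the categorified Burnside rig. -/
instance : CommSemiring (CategorifiedBurnsideRig G) where
  add_assoc a b c := by
    induction a using ind; induction b using ind; induction c using ind
    refine sound (.of_iso
      (sumElim (sumElim (inl _ _) ((inr _ _).comp (inl _ _))) ((inr _ _).comp (inr _ _)))
      (sumElim ((inl _ _).comp (inl _ _)) (sumElim ((inl _ _).comp (inr _ _)) (inr _ _)))
      ?_ ?_ ?_ ?_)
    · rintro ((_ | _) | _) <;> rfl
    · rintro ((_ | _) | _) <;> rfl
    · rintro (_ | (_ | _)) <;> rfl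
    · rintro (_ | (_ | _)) <;> rfl
  add_comm a b := by
    induction a using ind; induction b using ind
    refine sound (.of_iso (sumElim (inr _ _) (inl _ _)) (sumElim (inr _ _) (inl _ _))
      ?_ ?_ ?_ ?_) <;> rintro (_ | _) <;> rfl
  zero_add a := by
    induction a using ind
    refine sound (.of_iso (sumElim (fromEmpty _) (.id _)) (inr _ _) ?_ ?_ ?_ ?_)
    · rintro (x | _)
      · exact x.elim
      · rfl
    · rintro (x | _)
      · exact x.elim
      · rfl
    · exact fun _ => rfl
    · exact fun _ => rfl
  add_zero a := by
    induction a using ind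
    refine sound (.of_iso (sumElim (.id _) (fromEmpty _)) (inl _ _) ?_ ?_ ?_ ?_)
    · rintro (_ | x)
      · rfl
      · exact x.elim
    · rintro (_ | x)
      · rfl
      · exact x.elim
    · exact fun _ => rfl
    · exact fun _ => rfl
  mul_assoc a b c := by
    induction a using ind; induction b using ind; induction c using ind
    exact sound (.of_iso
      (prodLift ((fst _ _).comp (fst _ _)) (prodLift ((snd _ _).comp (fst _ _)) (snd _ _)))
      (prodLift (prodLift (fst _ _) ((fst _ _).comp (snd _ _))) ((snd _ _).comp (snd _ _)))
      (fun _ => rfl) (fun _ => rfl) (fun _ => rfl) (fun _ => rfl))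
  mul_comm := CategorifiedBurnsideRig.mul_comm
  one_mul a := by
    induction a using ind
    refine sound (.of_iso (snd _ _) (prodLift (toBase _) (.id _)) ?_ ?_ ?_ ?_)
    · rintro ⟨⟨_, _⟩, h⟩; exact Subtype.ext (Prod.ext h.symm rfl)
    · rintro ⟨⟨_, _⟩, h⟩; exact Subtype.ext (Prod.ext h.symm rfl)
    · exact fun _ => rfl
    · exact fun _ => rfl
  mul_one a := by
    induction a using ind
    refine sound (.of_iso (fst _ _) (prodLift (.id _) (toBase _)) ?_ ?_ ?_ ?_)
    · rintro ⟨⟨_, _⟩, h⟩; exact Subtype.ext (Prod.ext rfl h)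
    · rintro ⟨⟨_, _⟩, h⟩; exact Subtype.ext (Prod.ext rfl h)
    · exact fun _ => rfl
    · exact fun _ => rfl
  zero_mul a := by
    induction a using ind
    exact sound (.of_iso (fst _ _) (fromEmpty _)
      (fun x => x.1.1.elim) (fun x => x.1.1.elim) (fun x => x.elim) (fun x => x.elim))
  mul_zero a := by
    induction a using ind
    exact sound (.of_iso (snd _ _) (fromEmpty _)
      (fun x => x.1.2.elim) (fun x => x.1.2.elim) (fun x => x.elim) (fun x => x.elim))
  left_distrib a b c := by
    rw [CategorifiedBurnsideRig.mul_comm a (b + c), CategorifiedBurnsideRig.add_mul,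
      CategorifiedBurnsideRig.mul_comm b a, CategorifiedBurnsideRig.mul_comm c a]
  right_distrib := CategorifiedBurnsideRig.add_mul
  nsmul := nsmulRec
  npow := npowRec

end CategorifiedBurnsideRig

end

/-! ## The Grothendieck ring of a rig and the categorified Burnside ring -/

/-- The relation defining the Grothendieck ring of a rig: formal differences `a - b` and `c - d`
are identified when `a + d + e = c + b + e` for some `e`. -/
def grothendieckSetoid (S : Type*) [CommSemiring S] : Setoid (S × S) where
  r p q := ∃ e, p.1 + q.2 + e = q.1 + p.2 + e
  iseqv :=
    { refl := fun _ => ⟨0, rfl⟩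
      symm := fun ⟨e, h⟩ => ⟨e, h.symm⟩
      trans := by
        rintro ⟨a, b⟩ ⟨c, d⟩ ⟨x, y⟩ ⟨e, h⟩ ⟨f, k⟩
        refine ⟨c + d + e + f, ?_⟩
        dsimp only at h k ⊢
        calc a + y + (c + d + e + f) = (a + d + e) + (c + y + f) := by ring
          _ = (c + b + e) + (x + d + f) := by rw [h, k]
          _ = x + b + (c + d + e + f) := by ring }

/-- The Grothendieck ring of a rig `S`, whose elements are formal differences `a - b` of elements
of `S`. -/
def GrothendieckRing (S : Type*) [CommSemiring S] : Type _ :=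
  Quotient (grothendieckSetoid S)

namespace GrothendieckRing

variable {S : Type*} [CommSemiring S]

/-- The formal difference `a - b`. -/
def mk (a b : S) : GrothendieckRing S := Quotient.mk (grothendieckSetoid S) (a, b)

theorem sound {a b c d : S} (e : S) (h : a + d + e = c + b + e) : mk a b = mk c d :=
  Quotient.sound (s := grothendieckSetoid S) ⟨e, h⟩

theorem sound' {a b c d : S} (h : a + d = c + b) : mk a b = mk c d :=
  sound 0 (by rw [h])

theorem ind {P : GrothendieckRing S → Prop} (h : ∀ a b, P (mk a b)) (x : GrothendieckRing S) :
    P x :=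
  Quotient.ind (fun p => h p.1 p.2) x

instance : Zero (GrothendieckRing S) := ⟨mk 0 0⟩

instance : One (GrothendieckRing S) := ⟨mk 1 0⟩

/-- `(a - b) + (c - d) = (a + c) - (b + d)`. -/
instance : Add (GrothendieckRing S) :=
  ⟨Quotient.lift₂ (fun p q => mk (p.1 + q.1) (p.2 + q.2)) (by
    rintro ⟨a, b⟩ ⟨c, d⟩ ⟨a', b'⟩ ⟨c', d'⟩ ⟨e, h⟩ ⟨f, k⟩
    dsimp only at h k ⊢
    refine sound (e + f) ?_
    calc a + c + (b' + d') + (e + f) = (a + b' + e) + (c + d' + f) := by ring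
      _ = (a' + b + e) + (c' + d + f) := by rw [h, k]
      _ = a' + c' + (b + d) + (e + f) := by ring)⟩

/-- `-(a - b) = b - a`. -/
instance : Neg (GrothendieckRing S) :=
  ⟨Quotient.lift (fun p => mk p.2 p.1) (by
    rintro ⟨a, b⟩ ⟨a', b'⟩ ⟨e, h⟩
    dsimp only at h ⊢
    refine sound e ?_
    rw [add_comm b a', add_comm b' a, h])⟩

/-- `(a - b) (c - d) = (a c + b d) - (a d + b c)`. -/
instance : Mul (GrothendieckRing S) :=
  ⟨Quotient.lift₂ (fun p q => mk (p.1 * q.1 + p.2 * q.2) (p.1 * q.2 + p.2 * q.1)) (by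
    rintro ⟨a, b⟩ ⟨c, d⟩ ⟨a', b'⟩ ⟨c', d'⟩ ⟨e, h⟩ ⟨f, k⟩
    dsimp only at h k ⊢
    trans mk (a' * c + b' * d) (a' * d + b' * c)
    · refine sound (e * c + e * d) ?_
      calc a * c + b * d + (a' * d + b' * c) + (e * c + e * d)
          = (a + b' + e) * c + (a' + b + e) * d := by ring
        _ = (a' + b + e) * c + (a + b' + e) * d := by rw [h]
        _ = a' * c + b' * d + (a * d + b * c) + (e * c + e * d) := by ring
    · refine sound (a' * f + b' * f) ?_
      calc a' * c + b' * d + (a' * d' + b' * c') + (a' * f + b' * f)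
          = a' * (c + d' + f) + b' * (c' + d + f) := by ring
        _ = a' * (c' + d + f) + b' * (c + d' + f) := by rw [k]
        _ = a' * c' + b' * d' + (a' * d + b' * c) + (a' * f + b' * f) := by ring)⟩

theorem mk_add_mk (a b c d : S) : mk a b + mk c d = mk (a + c) (b + d) := rfl

theorem neg_mk (a b : S) : -mk a b = mk b a := rfl

theorem mk_mul_mk (a b c d : S) : mk a b * mk c d = mk (a * c + b * d) (a * d + b * c) := rfl

theorem zero_def : (0 : GrothendieckRing S) = mk 0 0 := rfl

theorem one_def : (1 : GrothendieckRing S) = mk 1 0 := rfl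

/-- The ring structure of the Grothendieck ring. -/
instance : CommRing (GrothendieckRing S) where
  add_assoc x y z := by
    induction x using ind; induction y using ind; induction z using ind
    simp only [mk_add_mk]; exact sound' (by ring)
  add_comm x y := by
    induction x using ind; induction y using ind
    simp only [mk_add_mk]; exact sound' (by ring)
  zero_add x := by
    induction x using ind
    simp only [zero_def, mk_add_mk]; exact sound' (by ring)
  add_zero x := by
    induction x using ind
    simp only [zero_def, mk_add_mk]; exact sound' (by ring)
  neg_add_cancel x := by
    induction x using ind
    simp only [zero_def, neg_mk, mk_add_mk]; exact sound' (by ring)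
  mul_assoc x y z := by
    induction x using ind; induction y using ind; induction z using ind
    simp only [mk_mul_mk]; exact sound' (by ring)
  mul_comm x y := by
    induction x using ind; induction y using ind
    simp only [mk_mul_mk]; exact sound' (by ring)
  one_mul x := by
    induction x using ind
    simp only [one_def, mk_mul_mk]; exact sound' (by ring)
  mul_one x := by
    induction x using ind
    simp only [one_def, mk_mul_mk]; exact sound' (by ring)
  zero_mul x := by
    induction x using ind
    simp only [zero_def, mk_mul_mk]; exact sound' (by ring)
  mul_zero x := by
    induction x using ind
    simp only [zero_def, mk_mul_mk]; exact sound' (by ring)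
  left_distrib x y z := by
    induction x using ind; induction y using ind; induction z using ind
    simp only [mk_mul_mk, mk_add_mk]; exact sound' (by ring)
  right_distrib x y z := by
    induction x using ind; induction y using ind; induction z using ind
    simp only [mk_mul_mk, mk_add_mk]; exact sound' (by ring)
  nsmul := nsmulRec
  zsmul := zsmulRec
  npow := npowRec

end GrothendieckRing

/-- The categorified Burnside ring of a groupoid: the Grothendieck ring of its categorified
Burnside rig. -/
abbrev CategorifiedBurnsideRing (G : Type u) [Groupoid.{u} G] : Type (u + 1) :=
  GrothendieckRing (CategorifiedBurnsideRig G)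

/-- A group `H` viewed as a groupoid with one object; the arrow `g h` is `h ≫ g`. -/
inductive OneObjectGroupoid (H : Type u) : Type u
  | pt : OneObjectGroupoid H

instance (H : Type u) [Group H] : Groupoid.{u} (OneObjectGroupoid H) where
  Hom _ _ := H
  id _ := 1
  comp h g := g * h
  id_comp := mul_one
  comp_id := one_mul
  assoc f g h := (mul_assoc h g f).symm
  inv g := g⁻¹
  inv_comp g := mul_inv_cancel g
  comp_inv g := inv_mul_cancel g

/-- The categorified Burnside ring of a group `H`, built from finite categorified `H`-sets. -/
abbrev GroupCategorifiedBurnsideRing (H : Type u) [Group H] : Type (u + 1) :=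
  CategorifiedBurnsideRing (OneObjectGroupoid H)

/-!
The isomorphism comes from the level of rigs. For an object `a`, passing to the fibres over `a`
turns a categorified `G`-set into a categorified set over the isotropy group `End a`; this preserves
finiteness, weak equivalences, disjoint unions and fibre products, hence is a homomorphism
`CategorifiedBurnsideRig.restrict a` of rigs. Together these homomorphisms, for `a ∈ R`, form an
isomorphism from the rig of `G` to the product of the rigs of the isotropy groups
(`CategorifiedBurnsideRig.bijective_restrict`), and Grothendieck rings commute with arbitrary
products (`GrothendieckRing.bijective_pi_map`).

The inverse glues sets `Y a` over the groups `End a` to a `G`-set (`RightGSet.glue`): a point over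
`x` is a family of equivariant maps `Hom(a, x) → Y a`, `a ∈ R`, on which arrows of `G` act by
precomposition. This is a coinduction, and needs no choice of arrows from the representatives; since
all structure is pointwise, it carries over to categorified sets, functors and natural isomorphisms.
As each `x` is connected to exactly one `a ∈ R`, a point over `x` is determined by one value of the
family. Hence the maps `x ↦ (k ↦ x k)` from a `G`-set to the gluing of its restrictions
(`EquivariantMap.bijective_toGlue`) and the evaluations at identities from the restrictions of a
gluing to the given sets (`EquivariantMap.bijective_evalGlue`) are bijective, and a functor that is
bijective on objects and on arrows is a weak equivalence (`WeaklyEquivalent.of_bijective`).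
-/

/-! ### Grothendieck rings of products of rigs -/

namespace GrothendieckRing

variable {S T : Type*} [CommSemiring S] [CommSemiring T]

theorem mk_eq_mk_iff {a b c d : S} : mk a b = mk c d ↔ ∃ e, a + d + e = c + b + e :=
  ⟨fun h => Quotient.exact h, fun ⟨e, h⟩ => sound e h⟩

/-- The ring homomorphism `a - b ↦ f a - f b` induced by a homomorphism `f` of rigs. -/
def map (f : S →+* T) : GrothendieckRing S →+* GrothendieckRing T where
  toFun := Quotient.lift (fun p => mk (f p.1) (f p.2)) (by
    rintro ⟨a, b⟩ ⟨c, d⟩ ⟨e, h⟩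
    refine sound (f e) ?_
    simpa only [map_add] using congrArg f h)
  map_zero' := congrArg₂ mk (map_zero f) (map_zero f)
  map_one' := congrArg₂ mk (map_one f) (map_zero f)
  map_add' x y := by
    induction x using ind; induction y using ind
    exact congrArg₂ mk (map_add f _ _) (map_add f _ _)
  map_mul' x y := by
    induction x using ind; induction y using ind
    refine congrArg₂ mk ?_ ?_ <;> simp only [map_add, map_mul]

theorem map_mk (f : S →+* T) (a b : S) : map f (mk a b) = mk (f a) (f b) := rfl

/-- The Grothendieck ring construction commutes with arbitrary products: the witnesses of equality
of formal differences can be chosen in each factor. -/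
theorem bijective_pi_map {ι : Type*} {T : ι → Type*} [∀ i, CommSemiring (T i)]
    (f : ∀ i, S →+* T i) (hf : Function.Bijective (RingHom.pi f)) :
    Function.Bijective (RingHom.pi fun i => map (f i)) := by
  constructor
  · intro x y hxy
    induction x using ind with | h a b
    induction y using ind with | h c d
    choose e he using fun i => mk_eq_mk_iff.1 (congrFun hxy i)
    obtain ⟨e, rfl⟩ := hf.2 e
    refine sound e (hf.1 ?_)
    rw [map_add, map_add, map_add, map_add]
    exact funext he
  · intro z
    have hz : ∀ i, ∃ p : T i × T i, mk p.1 p.2 = z i := fun i => by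
      generalize z i = w
      induction w using ind with | h a b
      exact ⟨(a, b), rfl⟩
    choose p hp using hz
    obtain ⟨a, ha⟩ := hf.2 fun i => (p i).1
    obtain ⟨b, hb⟩ := hf.2 fun i => (p i).2
    refine ⟨mk a b, funext fun i => ?_⟩
    rw [RingHom.pi_apply, map_mk, ← hp i]
    exact congrArg₂ mk (congrFun ha i) (congrFun hb i)

end GrothendieckRing

section

variable {G : Type u} [Groupoid.{u} G]

/-! ### Isomorphisms of categorified groupoid-sets -/

theorem RightGSet.act_id' (X : RightGSet G) (x : X.carrier) {a : G} (h : X.str x = a) :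
    X.act x (𝟙 a) h = x := by
  subst h; exact X.act_id x

/-- The inverse of a bijective equivariant map. -/
noncomputable def EquivariantMap.inverse {X Y : RightGSet G} (f : EquivariantMap X Y)
    (hf : Function.Bijective f.toFun) : EquivariantMap Y X where
  toFun := Function.surjInv hf.2
  str_map y := (f.str_map _).symm.trans (congrArg Y.str (Function.surjInv_eq hf.2 y))
  map_act y {_ _} g hy := hf.1 <| by
    refine (Function.surjInv_eq hf.2 _).trans (Eq.trans ?_ (f.map_act _ _ _).symm)
    exact Y.act_congr (Function.surjInv_eq hf.2 y).symm _ _ _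

theorem EquivariantMap.apply_inverse {X Y : RightGSet G} (f : EquivariantMap X Y)
    (hf : Function.Bijective f.toFun) (y : Y.carrier) : f.toFun ((f.inverse hf).toFun y) = y :=
  Function.surjInv_eq hf.2 y

theorem WeaklyEquivalent.of_bijective {X Y : CategorifiedGSet G} (φ : CatGFunctor X Y)
    (h₀ : Function.Bijective φ.ob.toFun) (h₁ : Function.Bijective φ.mor.toFun) :
    WeaklyEquivalent X Y :=
  of_iso φ
    { ob := φ.ob.inverse h₀
      mor := φ.mor.inverse h₁
      src_mor := fun p => h₀.1 <| by
        rw [← φ.src_mor, φ.ob.apply_inverse, φ.mor.apply_inverse]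
      tgt_mor := fun p => h₀.1 <| by
        rw [← φ.tgt_mor, φ.ob.apply_inverse, φ.mor.apply_inverse]
      map_idn := fun x => h₁.1 <| by
        rw [φ.map_idn, φ.ob.apply_inverse, φ.mor.apply_inverse]
      map_comp := fun p q h => h₁.1 <| by
        rw [φ.map_comp, φ.mor.apply_inverse]
        exact Y.comp_congr (φ.mor.apply_inverse h₁ p).symm
          (φ.mor.apply_inverse h₁ q).symm _ _ }
    (fun _ => h₀.1 (φ.ob.apply_inverse h₀ _)) (fun _ => h₁.1 (φ.mor.apply_inverse h₁ _))
    (φ.ob.apply_inverse h₀) (φ.mor.apply_inverse h₁)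

/-! ### Groupoid-sets over a group -/

namespace OneObjectGroupoid

variable {H : Type u}

theorem eq_pt (x : OneObjectGroupoid H) : x = pt := by cases x; rfl

instance : Subsingleton (OneObjectGroupoid H) :=
  ⟨fun x y => (eq_pt x).trans (eq_pt y).symm⟩

end OneObjectGroupoid

namespace RightGSet

variable {H : Type u} [Group H]

/-- The right translation `x ↦ x h` on a right `H`-set, for an element `h` of the group `H`. -/
def translate (X : RightGSet (OneObjectGroupoid H)) (x : X.carrier) (h : H) : X.carrier :=
  X.act x (a := .pt) (b := .pt) h (OneObjectGroupoid.eq_pt _)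

theorem act_eq_translate (X : RightGSet (OneObjectGroupoid H)) (x : X.carrier)
    {a b : OneObjectGroupoid H} (g : a ⟶ b) (hx : X.str x = b) :
    X.act x g hx = X.translate x g := by
  cases a; cases b; rfl

theorem translate_one (X : RightGSet (OneObjectGroupoid H)) (x : X.carrier) :
    X.translate x 1 = x :=
  X.act_id' x (OneObjectGroupoid.eq_pt _)

theorem translate_translate (X : RightGSet (OneObjectGroupoid H)) (x : X.carrier) (g h : H) :
    X.translate (X.translate x g) h = X.translate x (g * h) :=
  X.act_act x (a := .pt) (b := .pt) (c := .pt) g h (OneObjectGroupoid.eq_pt _)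

end RightGSet

theorem EquivariantMap.map_translate {H : Type u} [Group H] {X Y : RightGSet (OneObjectGroupoid H)}
    (f : EquivariantMap X Y) (x : X.carrier) (h : H) :
    f.toFun (X.translate x h) = Y.translate (f.toFun x) h :=
  f.map_act x _ _

theorem CategorifiedGSet.comp_translate {H : Type u} [Group H]
    (X : CategorifiedGSet (OneObjectGroupoid H)) (p q : X.Mor.carrier)
    (e : X.src.toFun p = X.tgt.toFun q) (h : H)
    (e' : X.src.toFun (X.Mor.translate p h) = X.tgt.toFun (X.Mor.translate q h)) :
    X.Mor.translate (X.comp p q e) h =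
      X.comp (X.Mor.translate p h) (X.Mor.translate q h) e' :=
  X.comp_act p q e _ _ _ e'

/-! ### Restriction to an isotropy group -/

/-- The restriction of a right `G`-set to the isotropy group at `a`: the fibre over `a`. -/
def RightGSet.restrict (a : G) (X : RightGSet G) : RightGSet (OneObjectGroupoid (End a)) where
  carrier := {x : X.carrier // X.str x = a}
  str _ := .pt
  act x {_ _} g _ := ⟨X.act x.1 (show a ⟶ a from g) x.2, X.str_act _ _ _⟩
  str_act _ {_ _} _ _ := Subsingleton.elim _ _
  act_id x := Subtype.ext (X.act_id' x.1 x.2)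
  act_act x {_ _ _} g h _ :=
    Subtype.ext (X.act_act x.1 (show a ⟶ a from g) (show a ⟶ a from h) x.2)

/-- The map between the fibres over `a` induced by an equivariant map. -/
def EquivariantMap.restrict (a : G) {X Y : RightGSet G} (f : EquivariantMap X Y) :
    EquivariantMap (X.restrict a) (Y.restrict a) where
  toFun x := ⟨f.toFun x.1, (f.str_map x.1).trans x.2⟩
  str_map _ := rfl
  map_act x {_ _} g _ := Subtype.ext (f.map_act x.1 (show a ⟶ a from g) x.2)

/-- The restriction of a categorified `G`-set to the isotropy group at `a`. -/
def CategorifiedGSet.restrict (a : G) (X : CategorifiedGSet G) :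
    CategorifiedGSet (OneObjectGroupoid (End a)) where
  Ob := X.Ob.restrict a
  Mor := X.Mor.restrict a
  src := X.src.restrict a
  tgt := X.tgt.restrict a
  idn := X.idn.restrict a
  comp p q h := ⟨X.comp p.1 q.1 (congrArg Subtype.val h), (X.str_comp _ _ _).trans p.2⟩
  str_comp _ _ _ := rfl
  comp_act p q _ {_ _} g _ _ h' :=
    Subtype.ext (X.comp_act p.1 q.1 _ (show a ⟶ a from g) p.2 q.2 (congrArg Subtype.val h'))
  src_idn _ := Subtype.ext (X.src_idn _)
  tgt_idn _ := Subtype.ext (X.tgt_idn _)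
  src_comp _ _ _ := Subtype.ext (X.src_comp _ _ _)
  tgt_comp _ _ _ := Subtype.ext (X.tgt_comp _ _ _)
  comp_assoc _ _ _ h₁ h₂ :=
    Subtype.ext (X.comp_assoc _ _ _ (congrArg Subtype.val h₁) (congrArg Subtype.val h₂))
  id_comp _ := Subtype.ext (X.id_comp _)
  comp_id _ := Subtype.ext (X.comp_id _)

/-- The restriction of an internal functor to the isotropy group at `a`. -/
def CatGFunctor.restrict (a : G) {X Y : CategorifiedGSet G} (F : CatGFunctor X Y) :
    CatGFunctor (X.restrict a) (Y.restrict a) where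
  ob := F.ob.restrict a
  mor := F.mor.restrict a
  src_mor _ := Subtype.ext (F.src_mor _)
  tgt_mor _ := Subtype.ext (F.tgt_mor _)
  map_idn _ := Subtype.ext (F.map_idn _)
  map_comp _ _ h := Subtype.ext (F.map_comp _ _ (congrArg Subtype.val h))

/-- The restriction of an internal natural transformation to the isotropy group at `a`. -/
def CatGTrans.restrict (a : G) {X Y : CategorifiedGSet G} {F K : CatGFunctor X Y}
    (α : CatGTrans F K) : CatGTrans (F.restrict a) (K.restrict a) where
  app := α.app.restrict a
  src_app _ := Subtype.ext (α.src_app _)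
  tgt_app _ := Subtype.ext (α.tgt_app _)
  naturality _ := Subtype.ext (α.naturality _)

/-- The restriction of an internal natural isomorphism to the isotropy group at `a`. -/
def CatGTransIso.restrict (a : G) {X Y : CategorifiedGSet G} {F K : CatGFunctor X Y}
    (α : CatGTransIso F K) : CatGTransIso (F.restrict a) (K.restrict a) where
  hom := α.hom.restrict a
  inv := α.inv.restrict a
  hom_inv _ := Subtype.ext (α.hom_inv _)
  inv_hom _ := Subtype.ext (α.inv_hom _)

theorem WeaklyEquivalent.restrict (a : G) {X Y : CategorifiedGSet G} (h : WeaklyEquivalent X Y) :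
    WeaklyEquivalent (X.restrict a) (Y.restrict a) :=
  let ⟨φ, ψ, ⟨α⟩, ⟨β⟩⟩ := h
  ⟨φ.restrict a, ψ.restrict a, ⟨α.restrict a⟩, ⟨β.restrict a⟩⟩

theorem CategorifiedGSet.IsFinite.restrict (a : G) {X : CategorifiedGSet G} (hX : X.IsFinite) :
    (X.restrict a).IsFinite := fun _ =>
  have : Finite {p : X.Mor.carrier // X.Mor.str p = a} := (hX a).to_subtype
  Set.toFinite (α := {p : X.Mor.carrier // X.Mor.str p = a}) _

namespace EquivariantMap

/-- The comparison map from the disjoint union of the fibres over `a` to the fibre of the disjoint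
union. -/
def restrictSum (a : G) (X Y : RightGSet G) :
    EquivariantMap ((X.restrict a).sum (Y.restrict a)) ((X.sum Y).restrict a) :=
  ((inl X Y).restrict a).sumElim ((inr X Y).restrict a)

theorem bijective_restrictSum (a : G) (X Y : RightGSet G) :
    Function.Bijective (restrictSum a X Y).toFun := by
  constructor
  · rintro (x | x) (y | y) h
    · exact congrArg Sum.inl (Subtype.ext (Sum.inl_injective (congrArg Subtype.val h)))
    · exact (Sum.inl_ne_inr (congrArg Subtype.val h)).elim
    · exact (Sum.inr_ne_inl (congrArg Subtype.val h)).elim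
    · exact congrArg Sum.inr (Subtype.ext (Sum.inr_injective (congrArg Subtype.val h)))
  · rintro ⟨x | x, hx⟩
    · exact ⟨.inl ⟨x, hx⟩, rfl⟩
    · exact ⟨.inr ⟨x, hx⟩, rfl⟩

/-- The comparison map from the fibre over `a` of a fibre product to the product of the fibres. -/
def restrictProd (a : G) (X Y : RightGSet G) :
    EquivariantMap ((X.prod Y).restrict a) ((X.restrict a).prod (Y.restrict a)) :=
  ((fst X Y).restrict a).prodLift ((snd X Y).restrict a)

theorem bijective_restrictProd (a : G) (X Y : RightGSet G) :
    Function.Bijective (restrictProd a X Y).toFun := by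
  constructor
  · rintro ⟨⟨⟨x, y⟩, _⟩, _⟩ ⟨⟨⟨x', y'⟩, _⟩, _⟩ h
    have hx : x = x' := congrArg (fun z => z.1.1.1) h
    have hy : y = y' := congrArg (fun z => z.1.2.1) h
    subst hx hy
    rfl
  · rintro ⟨⟨⟨x, hx⟩, ⟨y, hy⟩⟩, _⟩
    exact ⟨⟨⟨(x, y), hx.trans hy.symm⟩, hx⟩, rfl⟩

end EquivariantMap

namespace CategorifiedBurnsideRig

/-- Restriction to the isotropy group at `a` as a homomorphism of categorified Burnside rigs. -/
def restrict (a : G) :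
    CategorifiedBurnsideRig G →+* CategorifiedBurnsideRig (OneObjectGroupoid (End a)) where
  toFun := Quotient.map (fun X => ⟨X.1.restrict a, X.2.restrict a⟩) fun _ _ h => h.restrict a
  map_zero' := by
    refine (sound (.of_bijective (CatGFunctor.fromEmpty _) ?_ ?_)).symm
    all_goals exact ⟨fun x => x.elim, fun x => x.1.elim⟩
  map_one' := by
    refine sound (.of_bijective (CatGFunctor.toBase _) ?_ ?_)
    all_goals
      exact ⟨fun x y _ => Subtype.ext (x.2.trans y.2.symm),
        fun y => ⟨⟨a, rfl⟩, (OneObjectGroupoid.eq_pt y).symm⟩⟩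
  map_add' x y := by
    induction x using ind with | h X
    induction y using ind with | h Y
    refine (sound (.of_bijective
      (((CatGFunctor.inl X Y).restrict a).sumElim ((CatGFunctor.inr X Y).restrict a))
      (EquivariantMap.bijective_restrictSum a _ _)
      (EquivariantMap.bijective_restrictSum a _ _))).symm
  map_mul' x y := by
    induction x using ind with | h X
    induction y using ind with | h Y
    exact sound (.of_bijective
      (((CatGFunctor.fst X Y).restrict a).prodLift ((CatGFunctor.snd X Y).restrict a))
      (EquivariantMap.bijective_restrictProd a _ _)
      (EquivariantMap.bijective_restrictProd a _ _))

end CategorifiedBurnsideRig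

variable {R : Set G}

/-! ### Gluing sets over the isotropy groups to a groupoid-set -/

/-- An element over `pt` of the right `G`-set glued from right `G^a`-sets `Y a`, `a ∈ R`: a family
of `G^a`-equivariant maps from the arrows `a ⟶ pt` to `Y a`. If `R` represents the connected
components, then there are such arrows for a single `a` only, and the family amounts to one
element of `Y a`, after the choice of an arrow `a ⟶ pt`. -/
structure GlueElement (Y : (a : R) → RightGSet (OneObjectGroupoid (End (a : G)))) : Type u where
  pt : G
  val : (a : R) → ((a : G) ⟶ pt) → (Y a).carrier
  val_comp : ∀ (a : R) (h : (a : G) ⟶ a) (k : (a : G) ⟶ pt),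
    val a (h ≫ k) = (Y a).translate (val a k) h

namespace GlueElement

variable {Y Z : (a : R) → RightGSet (OneObjectGroupoid (End (a : G)))}

/-- The value of `p` at an arrow `a ⟶ x`, where `x` is only propositionally equal to `p.pt`. If the
two agree definitionally, so do `valAt` and `val`. -/
def valAt (p : GlueElement Y) {x : G} (e : p.pt = x) (a : R) (k : (a : G) ⟶ x) : (Y a).carrier :=
  p.val a (e ▸ k)

theorem valAt_translate (p : GlueElement Y) {x : G} (e : p.pt = x) (a : R) (h : (a : G) ⟶ a)
    (k : (a : G) ⟶ x) : p.valAt e a (h ≫ k) = (Y a).translate (p.valAt e a k) h := by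
  subst e; exact p.val_comp a h k

theorem mk_congr {x : G} {f g : (a : R) → ((a : G) ⟶ x) → (Y a).carrier}
    {hf : ∀ (a : R) (h : (a : G) ⟶ a) (k : (a : G) ⟶ x), f a (h ≫ k) = (Y a).translate (f a k) h}
    {hg : ∀ (a : R) (h : (a : G) ⟶ a) (k : (a : G) ⟶ x), g a (h ≫ k) = (Y a).translate (g a k) h}
    (h : ∀ a k, f a k = g a k) : (⟨x, f, hf⟩ : GlueElement Y) = ⟨x, g, hg⟩ := by
  obtain rfl : f = g := funext fun a => funext (h a)
  rfl

theorem valAt_mk {x : G} (f : (a : R) → ((a : G) ⟶ x) → (Y a).carrier)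
    (hf : ∀ (a : R) (h : (a : G) ⟶ a) (k : (a : G) ⟶ x), f a (h ≫ k) = (Y a).translate (f a k) h)
    (e : x = x) (a : R) (k : (a : G) ⟶ x) :
    (⟨x, f, hf⟩ : GlueElement Y).valAt e a k = f a k := rfl

theorem ext_valAt {p q : GlueElement Y} {x : G} (hp : p.pt = x) (hq : q.pt = x)
    (h : ∀ (a : R) (k : (a : G) ⟶ x), p.valAt hp a k = q.valAt hq a k) : p = q := by
  obtain ⟨y, f, hf⟩ := p
  obtain ⟨z, g, hg⟩ := q
  obtain rfl : y = x := hp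
  obtain rfl : z = y := hq
  exact mk_congr h

theorem valAt_congr {p q : GlueElement Y} (h : p = q) {x : G} (hp : p.pt = x) (hq : q.pt = x)
    (a : R) (k : (a : G) ⟶ x) : p.valAt hp a k = q.valAt hq a k := by
  subst h; rfl

/-- The image of a compatible family under a family of equivariant maps. -/
def map (f : ∀ a, EquivariantMap (Y a) (Z a)) (p : GlueElement Y) : GlueElement Z where
  pt := p.pt
  val a k := (f a).toFun (p.val a k)
  val_comp a h k := by rw [p.val_comp, (f a).map_translate]

theorem valAt_map (f : ∀ a, EquivariantMap (Y a) (Z a)) (p : GlueElement Y) {x : G} (e : p.pt = x)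
    (a : R) (k : (a : G) ⟶ x) : (p.map f).valAt e a k = (f a).toFun (p.valAt e a k) := by
  subst e; rfl

theorem pt_eq_of_map_eq {Y' : (a : R) → RightGSet (OneObjectGroupoid (End (a : G)))}
    {f : ∀ a, EquivariantMap (Y a) (Z a)} {g : ∀ a, EquivariantMap (Y' a) (Z a)}
    {p : GlueElement Y} {q : GlueElement Y'} (h : p.map f = q.map g) : q.pt = p.pt :=
  (congrArg pt h).symm

end GlueElement

/-- The right `G`-set glued from right `G^a`-sets `Y a`, `a ∈ R`. An arrow of `G` acts on a family
of maps by precomposition, so that neither the structure nor the axioms involve a choice of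
arrows between the objects of `G` and their representatives. -/
def RightGSet.glue (Y : (a : R) → RightGSet (OneObjectGroupoid (End (a : G)))) : RightGSet G where
  carrier := GlueElement Y
  str p := p.pt
  act p {x _} g hp :=
    { pt := x
      val := fun a k => p.valAt hp a (k ≫ g)
      val_comp := fun a h k => by rw [Category.assoc, p.valAt_translate] }
  str_act _ {_ _} _ _ := rfl
  act_id p := GlueElement.mk_congr fun a k => congrArg (p.val a) (Category.comp_id k)
  act_act p {_ _ _} g h hp := GlueElement.mk_congr fun a k =>
    (GlueElement.valAt_mk _ _ _ _ _).trans (congrArg (p.valAt hp a) (Category.assoc k h g))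

/-- The gluing of a family of equivariant maps. -/
def EquivariantMap.glue {Y Z : (a : R) → RightGSet (OneObjectGroupoid (End (a : G)))}
    (f : ∀ a, EquivariantMap (Y a) (Z a)) :
    EquivariantMap (RightGSet.glue Y) (RightGSet.glue Z) where
  toFun := GlueElement.map f
  str_map _ := rfl
  map_act p {_ _} g hp := GlueElement.mk_congr fun a k => (p.valAt_map f hp a (k ≫ g)).symm

/-- Composable compatible families are composable at each arrow `a ⟶ x`. -/
theorem GlueElement.src_valAt {Y : (a : R) → CategorifiedGSet (OneObjectGroupoid (End (a : G)))}
    {p q : GlueElement fun a => (Y a).Mor}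
    (h : p.map (fun a => (Y a).src) = q.map fun a => (Y a).tgt) {x : G} (e : p.pt = x)
    (e' : q.pt = x) (a : R) (k : (a : G) ⟶ x) :
    (Y a).src.toFun (p.valAt e a k) = (Y a).tgt.toFun (q.valAt e' a k) :=
  ((p.valAt_map _ e a k).symm.trans (valAt_congr h e e' a k)).trans (q.valAt_map _ e' a k)

/-- The pointwise composition of compatible families of arrows. Two composable families have the
same point `pt`, but only propositionally so. -/
def GlueElement.comp {Y : (a : R) → CategorifiedGSet (OneObjectGroupoid (End (a : G)))}
    (p q : GlueElement fun a => (Y a).Mor)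
    (h : p.map (fun a => (Y a).src) = q.map fun a => (Y a).tgt) :
    GlueElement fun a => (Y a).Mor :=
  have e : q.pt = p.pt := GlueElement.pt_eq_of_map_eq h
  have hpq : ∀ (a : R) (k : (a : G) ⟶ p.pt),
      (Y a).src.toFun (p.val a k) = (Y a).tgt.toFun (q.valAt e a k) := GlueElement.src_valAt h rfl e
  { pt := p.pt
    val := fun a k => (Y a).comp (p.val a k) (q.valAt e a k) (hpq a k)
    val_comp := fun a g k => by
      have h' := hpq a (g ≫ k)
      rw [p.val_comp, q.valAt_translate] at h'
      rw [(Y a).comp_translate _ _ _ _ h']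
      exact (Y a).comp_congr (p.val_comp a g k) (q.valAt_translate e a g k) _ _ }

theorem GlueElement.valAt_comp {Y : (a : R) → CategorifiedGSet (OneObjectGroupoid (End (a : G)))}
    (p q : GlueElement fun a => (Y a).Mor)
    (h : p.map (fun a => (Y a).src) = q.map fun a => (Y a).tgt) {x : G} (e : p.pt = x)
    (e' : q.pt = x) (a : R) (k : (a : G) ⟶ x) :
    (p.comp q h).valAt e a k = (Y a).comp (p.valAt e a k) (q.valAt e' a k)
      (src_valAt h e e' a k) := by
  subst e; rfl

/-- The categorified `G`-set glued from categorified `G^a`-sets `Y a`, `a ∈ R`. -/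
def CategorifiedGSet.glue (Y : (a : R) → CategorifiedGSet (OneObjectGroupoid (End (a : G)))) :
    CategorifiedGSet G where
  Ob := .glue fun a => (Y a).Ob
  Mor := .glue fun a => (Y a).Mor
  src := .glue fun a => (Y a).src
  tgt := .glue fun a => (Y a).tgt
  idn := .glue fun a => (Y a).idn
  comp := GlueElement.comp
  str_comp _ _ _ := rfl
  comp_act (p q : GlueElement fun a => (Y a).Mor) h {_ _} g hp hq h' :=
    GlueElement.mk_congr fun a k => p.valAt_comp q h hp hq a (k ≫ g)
  src_idn _ := GlueElement.mk_congr fun a _ => (Y a).src_idn _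
  tgt_idn _ := GlueElement.mk_congr fun a _ => (Y a).tgt_idn _
  src_comp (p q : GlueElement fun a => (Y a).Mor) h := by
    have e : q.pt = p.pt := GlueElement.pt_eq_of_map_eq h
    refine GlueElement.ext_valAt (x := p.pt) rfl e fun a k => ?_
    exact ((Y a).src_comp _ _ _).trans (q.valAt_map (fun a => (Y a).src) e a k).symm
  tgt_comp _ _ _ := GlueElement.mk_congr fun a _ => (Y a).tgt_comp _ _ _
  comp_assoc (p q r : GlueElement fun a => (Y a).Mor) h₁ h₂ := by
    have e : q.pt = p.pt := GlueElement.pt_eq_of_map_eq h₁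
    have e' : r.pt = q.pt := GlueElement.pt_eq_of_map_eq h₂
    refine GlueElement.mk_congr fun a k => ?_
    exact ((Y a).comp_assoc _ _ _ _ (GlueElement.src_valAt h₂ e (e'.trans e) a k)).trans
      ((Y a).comp_congr rfl (q.valAt_comp r h₂ e (e'.trans e) a k).symm _ _)
  id_comp _ := GlueElement.mk_congr fun a _ => (Y a).id_comp _
  comp_id _ := GlueElement.mk_congr fun a _ => (Y a).comp_id _

/-- The gluing of a family of internal functors. -/
def CatGFunctor.glue {Y Z : (a : R) → CategorifiedGSet (OneObjectGroupoid (End (a : G)))}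
    (F : ∀ a, CatGFunctor (Y a) (Z a)) :
    CatGFunctor (CategorifiedGSet.glue Y) (CategorifiedGSet.glue Z) where
  ob := .glue fun a => (F a).ob
  mor := .glue fun a => (F a).mor
  src_mor _ := GlueElement.mk_congr fun a _ => (F a).src_mor _
  tgt_mor _ := GlueElement.mk_congr fun a _ => (F a).tgt_mor _
  map_idn _ := GlueElement.mk_congr fun a _ => (F a).map_idn _
  map_comp (p q : GlueElement fun a => (Y a).Mor) h :=
    have e : q.pt = p.pt := GlueElement.pt_eq_of_map_eq h
    GlueElement.mk_congr fun a k => ((F a).map_comp _ _ _).trans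
      ((Z a).comp_congr rfl (q.valAt_map (fun a => (F a).mor) e a k).symm _ _)

/-- The gluing of a family of internal natural transformations. -/
def CatGTrans.glue {Y Z : (a : R) → CategorifiedGSet (OneObjectGroupoid (End (a : G)))}
    {F K : ∀ a, CatGFunctor (Y a) (Z a)} (α : ∀ a, CatGTrans (F a) (K a)) :
    CatGTrans (CatGFunctor.glue F) (CatGFunctor.glue K) where
  app := .glue fun a => (α a).app
  src_app _ := GlueElement.mk_congr fun a _ => (α a).src_app _
  tgt_app _ := GlueElement.mk_congr fun a _ => (α a).tgt_app _
  naturality p := GlueElement.mk_congr fun a k => (α a).naturality (p.val a k)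

/-- The gluing of a family of internal natural isomorphisms. -/
def CatGTransIso.glue {Y Z : (a : R) → CategorifiedGSet (OneObjectGroupoid (End (a : G)))}
    {F K : ∀ a, CatGFunctor (Y a) (Z a)} (α : ∀ a, CatGTransIso (F a) (K a)) :
    CatGTransIso (CatGFunctor.glue F) (CatGFunctor.glue K) where
  hom := .glue fun a => (α a).hom
  inv := .glue fun a => (α a).inv
  hom_inv _ := GlueElement.mk_congr fun a _ => (α a).hom_inv _
  inv_hom _ := GlueElement.mk_congr fun a _ => (α a).inv_hom _

theorem WeaklyEquivalent.glue
    {Y Z : (a : R) → CategorifiedGSet (OneObjectGroupoid (End (a : G)))}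
    (h : ∀ a, WeaklyEquivalent (Y a) (Z a)) :
    WeaklyEquivalent (CategorifiedGSet.glue Y) (CategorifiedGSet.glue Z) := by
  choose φ ψ α β using h
  exact ⟨.glue φ, .glue ψ, ⟨.glue fun a => (α a).some⟩, ⟨.glue fun a => (β a).some⟩⟩

/-! ### Gluing the restrictions of a groupoid-set -/

theorem RightGSet.act_injective (X : RightGSet G) {x y : X.carrier} {a b : G} (g : a ⟶ b)
    (hx : X.str x = b) (hy : X.str y = b) (h : X.act x g hx = X.act y g hy) : x = y := by
  have := X.act_congr h (Groupoid.inv g) (X.str_act _ _ _) (X.str_act _ _ _)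
  simpa only [X.act_act, Groupoid.inv_comp, X.act_id'] using this

/-- The family of maps `k ↦ x k` associated with a point `x` of a right `G`-set. -/
def GlueElement.orbit (R : Set G) (X : RightGSet G) (x : X.carrier) :
    GlueElement fun a : R => X.restrict (a : G) where
  pt := X.str x
  val _ k := ⟨X.act x k rfl, X.str_act _ _ _⟩
  val_comp _ h k := Subtype.ext (X.act_act x k h rfl).symm

theorem GlueElement.valAt_orbit (X : RightGSet G) (x : X.carrier) {b : G} (hx : X.str x = b)
    (a : R) (k : (a : G) ⟶ b) :
    (orbit R X x).valAt hx a k = ⟨X.act x k hx, X.str_act _ _ _⟩ := by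
  subst hx; rfl

/-- The canonical map from a right `G`-set to the gluing of its restrictions. -/
def EquivariantMap.toGlue (R : Set G) (X : RightGSet G) :
    EquivariantMap X (RightGSet.glue fun a : R => X.restrict (a : G)) where
  toFun := GlueElement.orbit R X
  str_map _ := rfl
  map_act x {_ _} g hx := GlueElement.ext_valAt (X.str_act x g hx) rfl fun a k => by
    rw [GlueElement.valAt_orbit]
    exact (Subtype.ext (X.act_act x g k hx)).trans (GlueElement.valAt_orbit X x hx a (k ≫ g)).symm

theorem EquivariantMap.bijective_toGlue (hex : ∀ x : G, ∃ a : R, Nonempty ((a : G) ⟶ x))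
    (huniq : ∀ a b : R, ((a : G) ⟶ b) → a = b) (X : RightGSet G) :
    Function.Bijective (toGlue R X).toFun := by
  constructor
  · intro x y h
    obtain ⟨a, ⟨k⟩⟩ := hex (X.str x)
    have e : X.str y = X.str x := (congrArg GlueElement.pt h).symm
    have hk := GlueElement.valAt_congr h rfl e a k
    exact X.act_injective k rfl e
      (congrArg Subtype.val (hk.trans (GlueElement.valAt_orbit X y e a k)))
  · intro (p : GlueElement fun a : R => X.restrict (a : G))
    obtain ⟨a, ⟨k⟩⟩ := hex p.pt
    -- The preimage of `p` is `(p k) k⁻¹`, for any arrow `k` from the representative.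
    refine ⟨X.act (p.val a k).1 (Groupoid.inv k) (p.val a k).2, ?_⟩
    refine GlueElement.ext_valAt (X.str_act _ _ _) rfl fun b l => ?_
    obtain rfl := huniq b a (l ≫ Groupoid.inv k)
    refine (GlueElement.valAt_orbit X _ (X.str_act _ _ _) b l).trans (Subtype.ext ?_)
    have hl : l = (l ≫ Groupoid.inv k) ≫ k := by simp
    exact (X.act_act _ _ _ _).trans (congrArg Subtype.val
      (((congrArg (p.val b) hl).trans (p.val_comp b _ k)).symm))

/-- The canonical functor from a categorified `G`-set to the gluing of its restrictions. -/
def CatGFunctor.toGlue (R : Set G) (X : CategorifiedGSet G) :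
    CatGFunctor X (CategorifiedGSet.glue fun a : R => X.restrict (a : G)) where
  ob := .toGlue R X.Ob
  mor := .toGlue R X.Mor
  src_mor p := GlueElement.ext_valAt rfl (X.src.str_map p) fun a k =>
    (Subtype.ext (X.src.map_act p k rfl)).trans (GlueElement.valAt_orbit X.Ob _ _ a k).symm
  tgt_mor p := GlueElement.ext_valAt rfl (X.tgt.str_map p) fun a k =>
    (Subtype.ext (X.tgt.map_act p k rfl)).trans (GlueElement.valAt_orbit X.Ob _ _ a k).symm
  map_idn x := GlueElement.ext_valAt (X.idn.str_map x) rfl fun a k =>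
    (GlueElement.valAt_orbit X.Mor _ _ a k).trans (Subtype.ext (X.idn.map_act x k rfl).symm)
  map_comp p q h := by
    have hq : X.Mor.str q = X.Mor.str p := by
      rw [← X.tgt.str_map q, ← h, X.src.str_map]
    refine GlueElement.ext_valAt (X.str_comp p q h) rfl fun a k => ?_
    have hk : X.src.toFun (X.Mor.act p k rfl) = X.tgt.toFun (X.Mor.act q k hq) :=
      (X.src.map_act p k rfl).trans ((X.Ob.act_congr h _ _ _).trans (X.tgt.map_act q k hq).symm)
    refine (GlueElement.valAt_orbit X.Mor _ _ a k).trans (Subtype.ext ?_)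
    exact (X.comp_act p q h k rfl hq hk).trans (X.comp_congr rfl
      (congrArg Subtype.val (GlueElement.valAt_orbit X.Mor q hq a k)).symm _ _)

/-! ### Restricting a glued groupoid-set -/

/-- Evaluation at the identity of `a`, from the fibre over `a` of a glued `G`-set to the given
`G^a`-set. -/
def EquivariantMap.evalGlue (Y : (a : R) → RightGSet (OneObjectGroupoid (End (a : G)))) (a : R) :
    EquivariantMap ((RightGSet.glue Y).restrict (a : G)) (Y a) where
  toFun p := GlueElement.valAt p.1 p.2 a (𝟙 (a : G))
  str_map _ := Subsingleton.elim _ _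
  map_act p {_ _} g _ := by
    rw [RightGSet.act_eq_translate]
    refine Eq.trans ?_ (GlueElement.valAt_translate p.1 p.2 a (show (a : G) ⟶ a from g) (𝟙 (a : G)))
    exact congrArg (GlueElement.valAt p.1 p.2 a)
      ((Category.id_comp (show (a : G) ⟶ a from g)).trans (Category.comp_id _).symm)

/-- An element of the glued set with a prescribed value `y` at the identity of `a`. -/
theorem GlueElement.exists_valAt_id (huniq : ∀ a b : R, ((a : G) ⟶ b) → a = b)
    (Y : (a : R) → RightGSet (OneObjectGroupoid (End (a : G)))) (a : R) (y : (Y a).carrier) :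
    ∃ (p : GlueElement Y) (hp : p.pt = a), p.valAt hp a (𝟙 (a : G)) = y := by
  -- An arrow `b ⟶ a` forces `b = a`, and the value at it is then the translate of `y`.
  refine ⟨⟨a, fun b k => Eq.rec (motive := fun (c : R) _ => ((c : G) ⟶ a) → (Y c).carrier)
    (fun l => (Y a).translate y l) (huniq b a k).symm k, fun b h k => ?_⟩, rfl,
    (GlueElement.valAt_mk _ _ _ _ _).trans ((Y a).translate_one y)⟩
  obtain rfl := huniq b a k
  exact ((Y b).translate_translate y k h).symm

theorem EquivariantMap.bijective_evalGlue (huniq : ∀ a b : R, ((a : G) ⟶ b) → a = b)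
    (Y : (a : R) → RightGSet (OneObjectGroupoid (End (a : G)))) (a : R) :
    Function.Bijective (evalGlue Y a).toFun := by
  constructor
  · rintro ⟨p, hp⟩ ⟨q, hq⟩ h
    -- By uniqueness of representatives `k` is an automorphism of `a`, and the value at `k` is the
    -- translate by `k` of the value at the identity.
    refine Subtype.ext (GlueElement.ext_valAt hp hq fun b k => ?_)
    obtain rfl := huniq b a k
    have key : ∀ (p : GlueElement Y) (hp : p.pt = b),
        p.valAt hp b k = (Y b).translate (p.valAt hp b (𝟙 (b : G))) k := fun p hp => by
      rw [← p.valAt_translate, Category.comp_id]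
    exact (key p hp).trans ((congrArg (fun z => (Y b).translate z k) h).trans (key q hq).symm)
  · intro y
    obtain ⟨p, hp, h⟩ := GlueElement.exists_valAt_id huniq Y a y
    exact ⟨⟨p, hp⟩, h⟩

/-- Evaluation at the identity of `a`, from the restriction of a glued categorified `G`-set to the
given categorified `G^a`-set. -/
def CatGFunctor.evalGlue (Y : (a : R) → CategorifiedGSet (OneObjectGroupoid (End (a : G))))
    (a : R) : CatGFunctor ((CategorifiedGSet.glue Y).restrict (a : G)) (Y a) where
  ob := .evalGlue _ a
  mor := .evalGlue _ a
  src_mor p := (GlueElement.valAt_map (fun a => (Y a).src) p.1 p.2 a _).symm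
  tgt_mor p := (GlueElement.valAt_map (fun a => (Y a).tgt) p.1 p.2 a _).symm
  map_idn x := GlueElement.valAt_map (fun a => (Y a).idn) x.1 x.2 a _
  map_comp p q h := GlueElement.valAt_comp p.1 q.1 (congrArg Subtype.val h) p.2 q.2 a _

/-- Acting by an arrow `a ⟶ x` embeds the fibre over `x` into the fibre over the representative `a`,
and the latter is in bijection with the arrows of `Y a`. -/
theorem CategorifiedGSet.IsFinite.glue (hex : ∀ x : G, ∃ a : R, Nonempty ((a : G) ⟶ x))
    (huniq : ∀ a b : R, ((a : G) ⟶ b) → a = b)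
    {Y : (a : R) → CategorifiedGSet (OneObjectGroupoid (End (a : G)))}
    (hY : ∀ a, (Y a).IsFinite) : (CategorifiedGSet.glue Y).IsFinite := by
  intro x
  obtain ⟨a, ⟨k⟩⟩ := hex x
  have : Finite (Y a).Mor.carrier := Set.finite_univ_iff.1 <|
    (hY a .pt).subset fun p _ => OneObjectGroupoid.eq_pt _
  have : Finite ((CategorifiedGSet.glue Y).Mor.restrict (a : G)).carrier :=
    Finite.of_injective (β := (Y a).Mor.carrier) _
      (EquivariantMap.bijective_evalGlue huniq (fun a => (Y a).Mor) a).1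
  refine @Set.toFinite _ _ (Finite.of_injective
    (β := ((CategorifiedGSet.glue Y).Mor.restrict (a : G)).carrier)
    (fun p => ⟨(CategorifiedGSet.glue Y).Mor.act p.1 k p.2, RightGSet.str_act _ _ _ _⟩) ?_)
  exact fun p q h => Subtype.ext (RightGSet.act_injective _ k p.2 q.2 (congrArg Subtype.val h))

/-! ### Decomposition of the categorified Burnside rig -/

theorem CategorifiedBurnsideRig.bijective_restrict
    (hex : ∀ x : G, ∃ a : R, Nonempty ((a : G) ⟶ x))
    (huniq : ∀ a b : R, ((a : G) ⟶ b) → a = b) :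
    Function.Bijective (RingHom.pi fun a : R => restrict (a : G)) := by
  constructor
  · intro x y hxy
    induction x using ind with | h X hX
    induction y using ind with | h Y hY
    have key : ∀ Z : CategorifiedGSet G, WeaklyEquivalent Z
        (CategorifiedGSet.glue fun a : R => Z.restrict (a : G)) := fun Z =>
      .of_bijective (CatGFunctor.toGlue R Z) (EquivariantMap.bijective_toGlue hex huniq _)
        (EquivariantMap.bijective_toGlue hex huniq _)
    have h : ∀ a : R, WeaklyEquivalent (X.restrict (a : G)) (Y.restrict (a : G)) := fun a =>
      Quotient.exact (congrFun hxy a)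
    exact sound ((key X).trans ((WeaklyEquivalent.glue h).trans (key Y).symm))
  · intro z
    have hz : ∀ a : R, ∃ (Y : CategorifiedGSet (OneObjectGroupoid (End (a : G))))
        (hY : Y.IsFinite), mk Y hY = z a := fun a => by
      generalize z a = w
      induction w using ind with | h Y hY
      exact ⟨Y, hY, rfl⟩
    choose Y hY hz using hz
    refine ⟨mk (CategorifiedGSet.glue Y) (.glue hex huniq hY), funext fun a => ?_⟩
    exact (sound (.of_bijective (CatGFunctor.evalGlue Y a)
      (EquivariantMap.bijective_evalGlue huniq _ a)
      (EquivariantMap.bijective_evalGlue huniq _ a))).trans (hz a)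

end

/-- For every groupoid `G` and every set `R` of representatives of its connected components, the
categorified Burnside ring of `G` is isomorphic, as a ring, to the product of the categorified
Burnside rings of the isotropy groups `End a`, `a ∈ R`. -/
theorem mainTheorem1 (G : Type u) [Groupoid.{u} G] (R : Set G)
    (hR : ∀ x : G, ∃! a : G, a ∈ R ∧ Nonempty (a ⟶ x)) :
    Nonempty (CategorifiedBurnsideRing G ≃+*
      ((a : R) → GroupCategorifiedBurnsideRing (End (a : G)))) := by
  have hex : ∀ x : G, ∃ a : R, Nonempty ((a : G) ⟶ x) := fun x =>
    let ⟨a, ha, _⟩ := hR x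
    ⟨⟨a, ha.1⟩, ha.2⟩
  have huniq : ∀ a b : R, ((a : G) ⟶ b) → a = b := fun a b k =>
    Subtype.ext ((hR b).unique ⟨a.2, ⟨k⟩⟩ ⟨b.2, ⟨𝟙 _⟩⟩)
  exact ⟨RingEquiv.ofBijective _ (GrothendieckRing.bijective_pi_map _
    (CategorifiedBurnsideRig.bijective_restrict hex huniq))⟩
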